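/- Let $p$ be a prime, let $\varphi\in\mathbb F_p[t]$ be an irreducible primitive polynomial (i.e. the class of $t$ generates the multiplicative group of the field $R=\mathbb F_p[t]/(\varphi)$), and let $K_1,K_2,K_3\le SL_3(R)$ be the groups of all matrices $$\begin{pmatrix}1&at&ct^2\\0&1&bt\\0&0&1\end{pmatrix},\quad \begin{pmatrix}1&0&0\\ct^2&1&at\\bt&0&1\end{pmatrix},\quad \begin{pmatrix}1&at&0\\0&1&0\\bt&ct^2&1\end{pmatrix}\qquad(a,b,c\in\mathbb F_p)$$ respectively. Let $G$ be the group generated by $K_1,K_2,K_3$, and let $X$ be the coset complex $X[G;K_1,K_2,K_3]$: its vertices are the cosets $gK_i$ (a vertex $gK_i$ has type $i$), and its faces are the nonempty sets of cosets that have a common element. Thus the triangles are the sets $\{gK_1,gK_2,gK_3\}$, $g\in G$ (identified with $g$), and an edge of type $i$ is a set $\{gK_j: j\ne i\}$. For a face $s$ let $T_s$ be the set of triangles containing $s$, and let $X_v$ be the link of a vertex $v$. For $\alpha\in\mathbb F_p$ let $h_1(\alpha),h_2(\alpha),h_3(\alpha)$ be the unipotent matrices whose only nonzero off-diagonal entry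 is $\alpha t$, at position $(3,1)$, $(1,2)$, $(2,3)$ respectively. Fix integers $d_1,d_2,d_3\ge 0$. For an edge $e=\{gK_j:j\neq i\}$ of type $i$, let $C_e$ be the set of all $f:T_e\to\mathbb F_p$ such that $\alpha\mapsto f(gh_i(\alpha))$ is a polynomial function of degree at most $d_i$; this does not depend on the choice of $g$. For a vertex $v$ let $C_v=\{f:T_v\to\mathbb F_p \mid f|_{T_e}\in C_e \text{ for all edges } e\ni v\}$. Let $\epsilon>0$ and let $\rho:\mathbb R_{\ge0}\to\mathbb R_{\ge0}$ be strictly increasing. The code $C_v$ is called $(\epsilon,\rho(\cdot))$-agreement testable if, for every collection of words $z_{uv}\in C_{uv}$, one for each vertex $u\in X_v(0)$ of the link, such that $$\alpha:=\Pr_{uw\in X_v(1)}\bigl[z_{uv}(uvw)\ne z_{wv}(uvw)\bigr]<\epsilon,$$ there is $x\in C_v$ with $\Pr_{u\in X_v(0)}\bigl[z_{uv}\ne x|_{T_{uv}}\bigr]\le\rho(\alpha)$ (both probabilities are uniform). **Statement.** Let $v$ be a vertex of type $i$, and put $d_x=d_{i+1}$, $d_y=d_{i-1}$ (indices mod 3).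 If $d_x+d_y<p/2$, then $C_v$ is isomorphic (via a bijection $\mathbb F_p^3\to T_v$ of the coordinate sets) to $$C_{d_x,d_y}=\{f:\mathbb F_p^3\to\mathbb F_p \mid \forall a,b,c:\ \deg_x f(x,b,c)\le d_x,\ \deg_y f(a,y,ay+c)\le d_y\},$$ and $C_v$ is $$\left(\left(\frac{p-2(d_x+d_y)}{5p}\right)^3,\ 4(\cdot)^{1/3}\right)\text{-agreement testable}.$$ -/

import Mathlib

/-! ### Simplicial complexes, stars, links, and uniform probabilities -/

namespace HDXCode

/-- The probability that `P` holds for a uniformly random element of the finite type `A`. -/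
noncomputable def unifProb (A : Type*) (P : A → Prop) : ℝ :=
  (Nat.card {a : A // P a} : ℝ) / (Nat.card A : ℝ)

/-- The `k`-dimensional faces of the star of `s`: all `t ∈ X` with `|t| = k + 1` and `s ⊆ t`. -/
def Star {V : Type*} (X : AbstractSimplicialComplex V) (s : Finset V) (k : ℕ) : Set (Finset V) :=
  {t | t ∈ X ∧ t.card = k + 1 ∧ s ⊆ t}

open Classical in
/-- The `k`-dimensional faces of the link of `s`: all `t` with `|t| = k + 1`, disjoint from `s`,
such that `s ∪ t ∈ X`. -/
def Link {V : Type*} (X : AbstractSimplicialComplex V) (s : Finset V) (k : ℕ) : Set (Finset V) :=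
  {t | t.card = k + 1 ∧ Disjoint s t ∧ s ∪ t ∈ X}

theorem star_anti {V : Type*} (X : AbstractSimplicialComplex V) {s s' : Finset V} (h : s ⊆ s')
    (k : ℕ) {t : Finset V} (ht : t ∈ Star X s' k) : t ∈ Star X s k :=
  ⟨ht.1, ht.2.1, h.trans ht.2.2⟩

open Classical in
theorem link_singleton_mem_star {V : Type*} (X : AbstractSimplicialComplex V) {v : V}
    {u s : Finset V} {k : ℕ} (hs : s ∈ Link X {v} k) (h : u ⊆ s) :
    {v} ∪ s ∈ Star X ({v} ∪ u) (k + 1) :=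
  ⟨hs.2.2, by rw [Finset.card_union_of_disjoint hs.2.1, hs.1, Finset.card_singleton]; omega,
    Finset.union_subset_union_right h⟩

/-! ### Codes on the triangles of a two-dimensional complex -/

/-- The vertex code `C_v`: the functions `f` on the triangles containing `v` whose restriction to
the triangles containing `e` lies in `C e`, for every edge `e` containing `v`. -/
def vertexCode {V F : Type*} (X : AbstractSimplicialComplex V)
    (C : (e : Finset V) → Set (Star X e 2 → F)) (v : V) : Set (Star X {v} 2 → F) :=
  {f | ∀ e (he : e ∈ Star X {v} 1),
    (fun t : Star X e 2 => f ⟨t.1, star_anti X he.2.2 2 t.2⟩) ∈ C e}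

open Classical in
/-- The fraction of edges `s = {u, w}` of the link of `v` such that the local views `z_{uv}` and
`z_{wv}` differ at the triangle `uvw`. Here `z u`, for `u` a vertex of the link of `v`, is the
local view at the edge `uv`. -/
noncomputable def disagreement {V F : Type*} (X : AbstractSimplicialComplex V) (v : V)
    (z : (u : Link X {v} 0) → Star X ({v} ∪ u.1) 2 → F) : ℝ :=
  unifProb (Link X {v} 1) fun s => ∃ (u w : Link X {v} 0) (hu : u.1 ⊆ s.1) (hw : w.1 ⊆ s.1),
    z u ⟨{v} ∪ s.1, link_singleton_mem_star X s.2 hu⟩ ≠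
      z w ⟨{v} ∪ s.1, link_singleton_mem_star X s.2 hw⟩

open Classical in
/-- The fraction of vertices `u` of the link of `v` such that the local view `z_{uv}` is not the
restriction of `x` to the triangles containing `uv`. -/
noncomputable def distanceFrom {V F : Type*} (X : AbstractSimplicialComplex V) (v : V)
    (z : (u : Link X {v} 0) → Star X ({v} ∪ u.1) 2 → F) (x : Star X {v} 2 → F) : ℝ :=
  unifProb (Link X {v} 0) fun u =>
    z u ≠ fun t => x ⟨t.1, star_anti X Finset.subset_union_left 2 t.2⟩

open Classical in
/-- `(ε, ρ)`-agreement testability of the vertex code `C_v`. -/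
def AgreementTestable {V F : Type*} (X : AbstractSimplicialComplex V)
    (C : (e : Finset V) → Set (Star X e 2 → F)) (v : V) (ε : ℝ) (ρ : ℝ → ℝ) : Prop :=
  0 < ε ∧ Set.MapsTo ρ (Set.Ici 0) (Set.Ici 0) ∧ StrictMonoOn ρ (Set.Ici 0) ∧
    ∀ z : (u : Link X {v} 0) → Star X ({v} ∪ u.1) 2 → F,
      (∀ u, z u ∈ C ({v} ∪ u.1)) → disagreement X v z < ε →
        ∃ x ∈ vertexCode X C v, distanceFrom X v z x ≤ ρ (disagreement X v z)

/-! ### Coset complexes -/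

/-- The coset complex: its vertices are the cosets of the subgroups `K i` (tagged by their type
`i`), and its faces are the nonempty finite sets of cosets that have a common element. -/
def cosetComplex {G ι : Type*} [Group G] (K : ι → Subgroup G) :
    AbstractSimplicialComplex (Σ i, G ⧸ K i) where
  faces := {s | s.Nonempty ∧ ∃ g : G, ∀ v ∈ s, (QuotientGroup.mk g : G ⧸ K v.1) = v.2}
  isRelLowerSet_faces := by
    rintro s ⟨hs, g, hg⟩
    exact ⟨hs, fun t hts ht => ⟨ht, g, fun v hv => hg v (hts hv)⟩⟩
  singleton_mem := by
    rintro ⟨i, v⟩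
    refine ⟨Finset.singleton_nonempty _, ?_⟩
    obtain ⟨g, rfl⟩ := QuotientGroup.mk_surjective v
    exact ⟨g, fun w hw => by rw [Finset.mem_singleton] at hw; subst hw; rfl⟩

open Classical in
/-- The set of cosets `{g K_i : i ∈ I}`. -/
noncomputable def cosetFace {G ι : Type*} [Group G] (K : ι → Subgroup G) (g : G) (I : Finset ι) :
    Finset (Σ i, G ⧸ K i) :=
  I.image fun i => ⟨i, QuotientGroup.mk g⟩

theorem cosetFace_mul_eq {G ι : Type*} [Group G] (K : ι → Subgroup G) (g h : G) (I : Finset ι)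
    (hh : ∀ i ∈ I, h ∈ K i) : cosetFace K (g * h) I = cosetFace K g I := by
  classical
  refine Finset.image_congr fun i hi => ?_
  simp only [Sigma.mk.injEq, heq_eq_eq, true_and]
  exact QuotientGroup.mk_mul_of_mem g (hh i hi)

theorem cosetFace_mem_star {G ι : Type*} [Group G] (K : ι → Subgroup G) (g : G) {I J : Finset ι}
    (hIJ : I ⊆ J) {k : ℕ} (hJ : J.card = k + 1) :
    cosetFace K g J ∈ Star (cosetComplex K) (cosetFace K g I) k := by
  classical
  refine ⟨⟨?_, g, ?_⟩, ?_, Finset.image_subset_image hIJ⟩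
  · exact Finset.Nonempty.image (Finset.card_pos.mp (by omega)) _
  · intro v hv
    obtain ⟨i, -, rfl⟩ := Finset.mem_image.mp hv
    rfl
  · rw [cosetFace, Finset.card_image_of_injective _ (fun i j h => congrArg Sigma.fst h), hJ]

/-! ### The matrix groups over `R = F[t] / (φ)` -/

open Polynomial

/-- `φ` is irreducible and the class `t` of the variable generates the multiplicative group of
the field `F[t] / (φ)`, which has `|F| ^ deg φ - 1` elements. -/
def IsPrimitivePoly {F : Type*} [Field F] (φ : F[X]) : Prop :=
  Irreducible φ ∧ orderOf (AdjoinRoot.root φ) = Nat.card F ^ φ.natDegree - 1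

/-- The general element of the group `K_1`, `K_2`, `K_3`; here and below the indices `1, 2, 3` are
represented by `0, 1, 2 : Fin 3`, so that `i + 1` and `i - 1` are cyclic. -/
noncomputable def kElt {F : Type*} [Field F] (φ : F[X]) (i : Fin 3) (a b c : F) :
    Matrix.SpecialLinearGroup (Fin 3) (AdjoinRoot φ) :=
  let t := AdjoinRoot.root φ
  let s := AdjoinRoot.of φ
  match i with
  | 0 => ⟨!![1, s a * t, s c * t ^ 2; 0, 1, s b * t; 0, 0, 1], by simp [Matrix.det_fin_three]⟩
  | 1 => ⟨!![1, 0, 0; s c * t ^ 2, 1, s a * t; s b * t, 0, 1], by simp [Matrix.det_fin_three]⟩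
  | 2 => ⟨!![1, s a * t, 0; 0, 1, 0; s b * t, s c * t ^ 2, 1], by simp [Matrix.det_fin_three]⟩

theorem kElt_zero {F : Type*} [Field F] (φ : F[X]) (i : Fin 3) : kElt φ i 0 0 0 = 1 := by
  fin_cases i <;> ext j k <;> fin_cases j <;> fin_cases k <;> simp [kElt]

theorem kElt_mul {F : Type*} [Field F] (φ : F[X]) (i : Fin 3) (a b c a' b' c' : F) :
    kElt φ i a b c * kElt φ i a' b' c' =
      kElt φ i (a + a') (b + b') (c + c' + if i = 2 then b * a' else a * b') := by
  refine Subtype.ext ?_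
  change (kElt φ i a b c).1 * (kElt φ i a' b' c').1 = _
  fin_cases i <;> ext j k <;> fin_cases j <;> fin_cases k <;>
    simp [kElt, Matrix.mul_apply, Fin.sum_univ_three] <;> ring

/-- The subgroups `K_1, K_2, K_3` of `SL_3(R)`. -/
noncomputable def kGroup {F : Type*} [Field F] (φ : F[X]) (i : Fin 3) :
    Subgroup (Matrix.SpecialLinearGroup (Fin 3) (AdjoinRoot φ)) where
  carrier := {M | ∃ a b c : F, M = kElt φ i a b c}
  one_mem' := ⟨0, 0, 0, (kElt_zero φ i).symm⟩
  mul_mem' := by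
    rintro _ _ ⟨a, b, c, rfl⟩ ⟨a', b', c', rfl⟩
    exact ⟨_, _, _, kElt_mul φ i a b c a' b' c'⟩
  inv_mem' := by
    rintro _ ⟨a, b, c, rfl⟩
    refine ⟨-a, -b, a * b - c, inv_eq_of_mul_eq_one_right ?_⟩
    rw [kElt_mul, ← kElt_zero φ i]
    congr 1
    · ring
    · ring
    · split_ifs <;> ring

/-- The group `G` generated by `K_1, K_2, K_3`. -/
noncomputable def bigGroup {F : Type*} [Field F] (φ : F[X]) :
    Subgroup (Matrix.SpecialLinearGroup (Fin 3) (AdjoinRoot φ)) :=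
  ⨆ i, kGroup φ i

/-- `K_i` as a subgroup of `G`. -/
noncomputable def kSub {F : Type*} [Field F] (φ : F[X]) (i : Fin 3) : Subgroup (bigGroup φ) :=
  (kGroup φ i).subgroupOf (bigGroup φ)

/-- The matrix `h_i(α)` with the only off-diagonal entry `α t`, at position `(3,1)`, `(1,2)`,
`(2,3)` for `i = 1, 2, 3`. -/
noncomputable def hMat {F : Type*} [Field F] (φ : F[X]) (i : Fin 3) (α : F) :
    Matrix.SpecialLinearGroup (Fin 3) (AdjoinRoot φ) :=
  let t := AdjoinRoot.root φ
  let s := AdjoinRoot.of φ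
  match i with
  | 0 => ⟨!![1, 0, 0; 0, 1, 0; s α * t, 0, 1], by simp [Matrix.det_fin_three]⟩
  | 1 => ⟨!![1, s α * t, 0; 0, 1, 0; 0, 0, 1], by simp [Matrix.det_fin_three]⟩
  | 2 => ⟨!![1, 0, 0; 0, 1, s α * t; 0, 0, 1], by simp [Matrix.det_fin_three]⟩

theorem hMat_mem {F : Type*} [Field F] (φ : F[X]) (i j : Fin 3) (hij : j ≠ i) (α : F) :
    hMat φ i α ∈ kGroup φ j := by
  fin_cases i <;> fin_cases j <;> first | exact absurd rfl hij | skip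
  · exact ⟨0, α, 0, by ext j k; fin_cases j <;> fin_cases k <;> simp [kElt, hMat]⟩
  · exact ⟨0, α, 0, by ext j k; fin_cases j <;> fin_cases k <;> simp [kElt, hMat]⟩
  · exact ⟨α, 0, 0, by ext j k; fin_cases j <;> fin_cases k <;> simp [kElt, hMat]⟩
  · exact ⟨α, 0, 0, by ext j k; fin_cases j <;> fin_cases k <;> simp [kElt, hMat]⟩
  · exact ⟨0, α, 0, by ext j k; fin_cases j <;> fin_cases k <;> simp [kElt, hMat]⟩
  · exact ⟨α, 0, 0, by ext j k; fin_cases j <;> fin_cases k <;> simp [kElt, hMat]⟩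

/-- `h_i(α)` as an element of `G`. -/
noncomputable def hElt {F : Type*} [Field F] (φ : F[X]) (i : Fin 3) (α : F) : bigGroup φ :=
  ⟨hMat φ i α, le_iSup (kGroup φ) (i + 1)
    (hMat_mem φ i (i + 1) (by fin_cases i <;> decide) α)⟩

theorem hElt_mem {F : Type*} [Field F] (φ : F[X]) (i j : Fin 3) (hij : j ≠ i) (α : F) :
    hElt φ i α ∈ kSub φ j :=
  Subgroup.mem_subgroupOf.mpr (hMat_mem φ i j hij α)

/-! ### The complex `X[G; K_1, K_2, K_3]` and its codes -/

/-- The vertices of `X[G; K_1, K_2, K_3]`; the first component is the type of the vertex. -/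
abbrev Vertex {F : Type*} [Field F] (φ : F[X]) : Type _ := Σ i : Fin 3, bigGroup φ ⧸ kSub φ i

/-- The triangle complex `X[G; K_1, K_2, K_3]`. -/
noncomputable def triComplex {F : Type*} [Field F] (φ : F[X]) :
    AbstractSimplicialComplex (Vertex φ) :=
  cosetComplex (kSub φ)

/-- The type-`i` edge `{g K_j : j ≠ i}`. -/
noncomputable def edgeOf {F : Type*} [Field F] (φ : F[X]) (i : Fin 3) (g : bigGroup φ) :
    Finset (Vertex φ) :=
  cosetFace (kSub φ) g {i}ᶜ

/-- The triangle `{g K_1, g K_2, g K_3}` of the group element `g`. -/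
noncomputable def triangleOf {F : Type*} [Field F] (φ : F[X]) (g : bigGroup φ) :
    Finset (Vertex φ) :=
  cosetFace (kSub φ) g Finset.univ

theorem triangleOf_mem_star {F : Type*} [Field F] (φ : F[X]) (i : Fin 3) (g : bigGroup φ) (α : F)
    {e : Finset (Vertex φ)} (he : e = edgeOf φ i g) :
    triangleOf φ (g * hElt φ i α) ∈ Star (triComplex φ) e 2 := by
  have h : edgeOf φ i (g * hElt φ i α) = edgeOf φ i g :=
    cosetFace_mul_eq _ _ _ _ fun j hj => hElt_mem φ i j (by simpa using hj) α
  rw [he, ← h]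
  exact cosetFace_mem_star _ _ (Finset.subset_univ _) (by simp)

/-- The Reed–Solomon code: the functions `F → F` given by polynomials of degree at most `d`. -/
def reedSolomon (F : Type*) [Field F] (d : ℕ) : Set (F → F) :=
  {f | ∃ P : F[X], P.natDegree ≤ d ∧ ∀ α, f α = P.eval α}

/-- The edge code `C_e`: if `e` is the type-`i` edge of `g`, then `α ↦ f(g h_i(α))` is a function
of degree at most `d_i`. (All choices of the representative `g` give the same condition.) -/
def edgeCode {F : Type*} [Field F] (φ : F[X]) (d : Fin 3 → ℕ) (e : Finset (Vertex φ)) :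
    Set (Star (triComplex φ) e 2 → F) :=
  {f | ∀ (i : Fin 3) (g : bigGroup φ) (he : e = edgeOf φ i g),
    (fun α => f ⟨triangleOf φ (g * hElt φ i α), triangleOf_mem_star φ i g α he⟩) ∈
      reedSolomon F (d i)}

/-- The code `C_{d_x,d_y}` of functions on `F ^ 3`. -/
def skewCode (F : Type*) [Field F] (dx dy : ℕ) : Set (F × F × F → F) :=
  {f | (∀ b c, (fun x => f (x, b, c)) ∈ reedSolomon F dx) ∧
    ∀ a c, (fun y => f (a, y, a * y + c)) ∈ reedSolomon F dy}

end HDXCode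

/-! Each `K_i` carries Heisenberg coordinates (`heis`) in which right multiplication by `h_{i+1}`
and `h_{i-1}` traces the lines (x, b, c) and (a, y, ay + c). The triangles at v become the points of
F_p^3, the link vertices become the lines of the two directions, and the link edges become incident
pairs of lines, one for each point. This identifies C_v with `skewCode`. Agreement testing now
reads: univariate polynomials Z on the x-lines and W on the y-lines disagree at few points; find a
codeword equal to most of them.

The method is an error locator in the style of Polishchuk and Spielman. With fewer than (A + 1)^3
bad points, linear algebra yields E ≠ 0 of degree at most A along both kinds of lines that vanishes
at all of them (`exists_vanishing`). Then E·Z = E·W everywhere, so this function is a word of a code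
with larger degrees, hence given by a polynomial P (`exists_poly_of_mem_skewCode`). E divides P on
every line, which forces E ∣ P (`dvd_of_dvd_lines`). The quotient is a codeword that agrees with the
local view on every line where E is not identically zero, and E vanishes on at most 2Ap lines of
each direction (`card_lineX_eq_zero_le`).

For the divisibility, remove the gcd and take the resultant in x, a nonzero polynomial in y, z.
Where f divides h on the x-line over (b, c), the resultant vanishes at (b, c) to order deg_x f
(`X_pow_dvd_pencil_resultant`). Schwartz–Zippel with multiplicities (`sum_multiplicity_le`) bounds
the number of such points, given a good bound on the total degree of the resultant. That bound comes
from the substitution (x + s, b + T, c + sT): translating x by s does not change the resultant, and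
xy − z becomes x(b + T) + (sb − c), in which the term sT has cancelled (`weightLE_taylor_pencil`).
The involution `flip₃` exchanges the two directions, so the arguments only have to be made along x.

Finally, write the disagreement as s^3 and take A = ⌊sp⌋: there are (sp)^3 < (A + 1)^3 bad points at
most, and the bound on the disagreement gives 2(d_x + d_y) + 5A < p. -/

namespace HDXCode

open Polynomial

/-! ### Polynomials in two and three variables -/

section Substitution

variable {F : Type*} [Field F] {S S' : Type*} [CommRing S] [Algebra F S] [CommRing S']
  [Algebra F S']

/-- Substitution in a polynomial in two variables; the inner variable becomes `y` and the outer one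
becomes `z`. -/
noncomputable def subst₂ (y z : S) : F[X][X] →ₐ[F] S :=
  eval₂AlgHom (aeval y) z fun _ => Commute.all _ _

@[simp] theorem subst₂_C (y z : S) (q : F[X]) : subst₂ y z (C q) = aeval y q := by
  simp [subst₂]

@[simp] theorem subst₂_X (y z : S) : subst₂ (F := F) y z X = z := by
  simp [subst₂]

theorem algHom₂_ext {f g : F[X][X] →ₐ[F] S} (hy : f (C X) = g (C X)) (hz : f X = g X) : f = g := by
  refine AlgHom.coe_ringHom_injective (Polynomial.ringHom_ext' ?_ (by simpa using hz))
  refine Polynomial.ringHom_ext' ?_ (by simpa using hy)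
  ext a
  have h (k : F[X][X] →ₐ[F] S) : k (C (C a)) = algebraMap F S a := k.commutes a
  simp [h]

/-- Substitution in a polynomial in three variables; the outer variable becomes `x`. -/
noncomputable def subst₃ (x y z : S) : F[X][X][X] →ₐ[F] S :=
  eval₂AlgHom (subst₂ y z) x fun _ => Commute.all _ _

@[simp] theorem subst₃_C (x y z : S) (q : F[X][X]) : subst₃ x y z (C q) = subst₂ y z q := by
  simp [subst₃]

@[simp] theorem subst₃_X (x y z : S) : subst₃ (F := F) x y z X = x := by
  simp [subst₃]

theorem algHom₃_ext {f g : F[X][X][X] →ₐ[F] S} (hx : f X = g X) (hy : f (C (C X)) = g (C (C X)))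
    (hz : f (C X) = g (C X)) : f = g := by
  refine AlgHom.coe_ringHom_injective (Polynomial.ringHom_ext' ?_ (by simpa using hx))
  have : f.comp (CAlgHom (R := F)) = g.comp (CAlgHom (R := F)) :=
    algHom₂_ext (by simpa using hy) (by simpa using hz)
  exact congrArg AlgHom.toRingHom this

theorem map_subst₂ (k : S →ₐ[F] S') (y z : S) (q : F[X][X]) :
    k (subst₂ y z q) = subst₂ (k y) (k z) q :=
  DFunLike.congr_fun (algHom₂_ext (f := k.comp (subst₂ y z)) (by simp) (by simp)) q

theorem map_subst₃ (k : S →ₐ[F] S') (x y z : S) (f : F[X][X][X]) :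
    k (subst₃ x y z f) = subst₃ (k x) (k y) (k z) f :=
  DFunLike.congr_fun
    (algHom₃_ext (f := k.comp (subst₃ x y z)) (by simp) (by simp) (by simp)) f

/-- Substituting in the two inner variables only. -/
theorem map_subst₂_eq_subst₃ (y z : S) (f : F[X][X][X]) :
    f.map (subst₂ (F := F) y z : F[X][X] →+* S) = subst₃ X (C y) (C z) f := by
  have := DFunLike.congr_fun (algHom₃_ext (f := mapAlgHom (subst₂ (F := F) y z))
    (g := subst₃ X (C y) (C z)) (by simp) (by simp) (by simp)) f
  simpa using this

/-- The univariate polynomial `f(x, b, c)`. -/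
noncomputable def lineX (f : F[X][X][X]) (b c : F) : F[X] :=
  subst₃ X (C b) (C c) f

/-- The value `f(a, b, c)`. -/
noncomputable def eval₃ (f : F[X][X][X]) (a b c : F) : F :=
  subst₃ a b c f

theorem lineX_eq_map (f : F[X][X][X]) (b c : F) :
    lineX f b c = f.map (subst₂ (F := F) b c : F[X][X] →+* F) :=
  (map_subst₂_eq_subst₃ b c f).symm

theorem natDegree_lineX_le (f : F[X][X][X]) (b c : F) : (lineX f b c).natDegree ≤ f.natDegree := by
  rw [lineX_eq_map]
  exact natDegree_map_le

@[simp] theorem coeff_lineX (f : F[X][X][X]) (b c : F) (m : ℕ) :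
    (lineX f b c).coeff m = subst₂ b c (f.coeff m) := by
  simp [lineX_eq_map]

theorem eval_lineX (f : F[X][X][X]) (a b c : F) : (lineX f b c).eval a = eval₃ f a b c := by
  have := map_subst₃ (aeval a : F[X] →ₐ[F] F) X (C b) (C c) f
  simpa [lineX, eval₃, aeval_def] using this

@[simp] theorem lineX_mul (f g : F[X][X][X]) (b c : F) :
    lineX (f * g) b c = lineX f b c * lineX g b c := by
  simp [lineX]

@[simp] theorem eval₃_add (f g : F[X][X][X]) (a b c : F) :
    eval₃ (f + g) a b c = eval₃ f a b c + eval₃ g a b c := by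
  simp [eval₃]

@[simp] theorem eval₃_mul (f g : F[X][X][X]) (a b c : F) :
    eval₃ (f * g) a b c = eval₃ f a b c * eval₃ g a b c := by
  simp [eval₃]

/-- The involution `f(x, y, z) ↦ f(y, x, x y - z)`. -/
noncomputable def flip₃ : F[X][X][X] →ₐ[F] F[X][X][X] :=
  subst₃ (C (C (X : F[X]))) X (X * C (C X) - C X)

@[simp] theorem flip₃_X : flip₃ (F := F) X = C (C X) := by simp [flip₃]

@[simp] theorem flip₃_C_C_X : flip₃ (F := F) (C (C X)) = X := by simp [flip₃]

@[simp] theorem flip₃_C_X : flip₃ (F := F) (C X) = X * C (C X) - C X := by simp [flip₃]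

@[simp] theorem flip₃_flip₃ (f : F[X][X][X]) : flip₃ (flip₃ f) = f := by
  have : (flip₃ (F := F)).comp flip₃ = AlgHom.id F _ := by
    refine algHom₃_ext (S := F[X][X][X]) ?_ ?_ ?_ <;> simp [map_sub (flip₃ (F := F))]
    ring
  exact DFunLike.congr_fun this f

theorem flip₃_injective : Function.Injective (flip₃ (F := F)) :=
  Function.LeftInverse.injective flip₃_flip₃

theorem subst₃_flip₃ (x y z : S) (f : F[X][X][X]) :
    subst₃ x y z (flip₃ f) = subst₃ y x (x * y - z) f := by
  refine (map_subst₃ (S := F[X][X][X]) (subst₃ x y z) _ _ _ f).trans ?_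
  simp [map_sub (subst₃ (F := F) x y z), mul_comm]

theorem eval₃_flip₃ (f : F[X][X][X]) (a b c : F) :
    eval₃ (flip₃ f) a b c = eval₃ f b a (a * b - c) :=
  subst₃_flip₃ a b c f

theorem isRelPrime_flip₃ {f g : F[X][X][X]} (h : IsRelPrime f g) :
    IsRelPrime (flip₃ f) (flip₃ g) := by
  intro d hf hg
  have h1 : flip₃ d ∣ f := by simpa using map_dvd flip₃ hf
  have h2 : flip₃ d ∣ g := by simpa using map_dvd flip₃ hg
  simpa using (h h1 h2).map flip₃

end Substitution

/-! ### Total degree and multiplicities of polynomials in two variables -/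

section Bivariate

variable {F : Type*} [Field F]

/-- A subspace that contains every monomial of `f` contains `f`. -/
theorem mem_of_monomials₂ (Q : Submodule F F[X][X]) (R : F[X][X])
    (h : ∀ i j, (R.coeff j).coeff i ≠ 0 → (C X ^ i * X ^ j : F[X][X]) ∈ Q) : R ∈ Q := by
  rw [R.as_sum_support_C_mul_X_pow]
  refine Q.sum_mem fun j _ => ?_
  rw [(R.coeff j).as_sum_support_C_mul_X_pow, map_sum, Finset.sum_mul]
  refine Q.sum_mem fun i hi => ?_
  have : C (C ((R.coeff j).coeff i) * X ^ i) * X ^ j =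
      (R.coeff j).coeff i • (C X ^ i * X ^ j : F[X][X]) := by
    rw [Algebra.smul_def]
    simp [mul_assoc]
  rw [this]
  exact Q.smul_mem _ (h i j (mem_support_iff.mp hi))

/-- The restriction `R(b + T, c + s T)` of a polynomial in two variables to the general line
through `(b, c)`; here `T` is the outer and `s` is the inner variable. -/
noncomputable def pencil (b c : F) : F[X][X] →ₐ[F] F[X][X] :=
  subst₂ (C (C b) + X) (C (C c) + C X * X)

@[simp] theorem pencil_C_X (b c : F) : pencil b c (C X) = C (C b) + X := by simp [pencil]

@[simp] theorem pencil_X (b c : F) : pencil b c X = C (C c) + C X * X := by simp [pencil]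

@[simp] theorem pencil_C_C (b c a : F) : pencil b c (C (C a)) = C (C a) :=
  (pencil b c).commutes a

/-- The monomial y^i z^k becomes s^k T^(i+k), so the coefficient of T^n is the dehomogenized part of
degree n, and the degree in T measures the total degree. -/
theorem coeff_pencil_zero (R : F[X][X]) (n j : ℕ) :
    ((pencil 0 0 R).coeff n).coeff j = if j ≤ n then (R.coeff j).coeff (n - j) else 0 := by
  induction R using Polynomial.induction_on' with
  | add P Q hP hQ =>
    rw [map_add, coeff_add, coeff_add, hP, hQ, coeff_add, coeff_add]
    split_ifs <;> simp
  | monomial k r =>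
    induction r using Polynomial.induction_on' with
    | add P Q hP hQ =>
      rw [map_add, map_add, coeff_add, coeff_add, hP, hQ, coeff_add, coeff_add]
      split_ifs <;> simp
    | monomial i a =>
      have : pencil 0 0 (monomial k (monomial i a)) = monomial (i + k) (monomial k a) := by
        rw [← C_mul_X_pow_eq_monomial, ← C_mul_X_pow_eq_monomial, ← C_mul_X_pow_eq_monomial,
          ← C_mul_X_pow_eq_monomial, C_mul, C_mul]
        simp
        ring
      rw [this]
      simp only [coeff_monomial]
      split_ifs <;> simp_all [coeff_monomial] <;> omega

/-- The pencil at (b, c) is an invertible translation followed by the pencil at the origin, which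
merely rearranges coefficients. -/
theorem pencil_injective (b c : F) : Function.Injective (pencil b c) := by
  have h0 : Function.Injective (pencil (0 : F) 0) := by
    rw [injective_iff_map_eq_zero]
    intro R hR
    ext j i
    have := coeff_pencil_zero R (i + j) j
    simpa [hR] using this.symm
  have hcomp (b c : F) (R : F[X][X]) : pencil b c R =
      pencil 0 0 (subst₂ (C (C b) + C X) (C (C c) + X) R) := by
    rw [pencil, map_subst₂]
    simp
  have htrans (R : F[X][X]) : subst₂ (C (C (-b)) + C X) (C (C (-c)) + X)
      (subst₂ (C (C b) + C X) (C (C c) + X) R) = R := by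
    refine (map_subst₂ (S := F[X][X]) (subst₂ (C (C (-b)) + C X) (C (C (-c)) + X)) _ _ R).trans ?_
    have : subst₂ (C (X : F[X])) X = AlgHom.id F F[X][X] := algHom₂_ext (by simp) (by simp)
    simpa using DFunLike.congr_fun this R
  intro R R' h
  rw [hcomp, hcomp b c R'] at h
  rw [← htrans R, h0 h, htrans]

/-- The polynomials of total degree at most `N`. -/
def TotalDegreeLE (N : ℕ) (R : F[X][X]) : Prop :=
  ∀ i j, (R.coeff j).coeff i ≠ 0 → i + j ≤ N

theorem totalDegreeLE_of_natDegree_pencil {R : F[X][X]} {N : ℕ}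
    (h : (pencil 0 0 R).natDegree ≤ N) : TotalDegreeLE N R := by
  intro i j hij
  by_contra hN
  apply hij
  have := coeff_pencil_zero R (i + j) j
  rw [coeff_eq_zero_of_natDegree_lt (p := pencil 0 0 R) (by omega)] at this
  simpa using this.symm

theorem natDegree_pencil_le {R : F[X][X]} {N : ℕ} (h : TotalDegreeLE N R) (b c : F) :
    (pencil b c R).natDegree ≤ N := by
  have := mem_of_monomials₂
    (((degreeLE F[X] N).restrictScalars F).comap (pencil b c).toLinearMap) R fun i j hij => ?_
  · simpa [mem_degreeLE, natDegree_le_iff_degree_le] using this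
  · have h1 : (C (C b) + X : F[X][X]).natDegree ≤ 1 := by compute_degree
    have h2 : (C (C c) + C X * X : F[X][X]).natDegree ≤ 1 := by compute_degree
    have h3 := (natDegree_mul_le (p := (C (C b) + X : F[X][X]) ^ i)
      (q := (C (C c) + C X * X : F[X][X]) ^ j))
    have h4 := natDegree_pow_le_of_le i h1
    have h5 := natDegree_pow_le_of_le j h2
    have h6 := h i j hij
    simp only [Submodule.mem_comap, Submodule.restrictScalars_mem, AlgHom.toLinearMap_apply,
      map_mul, map_pow, pencil_C_X, pencil_X, mem_degreeLE, ← natDegree_le_iff_degree_le]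
    omega

/-- At T = 0 all lines of the pencil are at their centre. Divisibility by a power of T is how
multiplicity at (b, c) is expressed throughout. -/
theorem X_dvd_pencil_iff {R : F[X][X]} {b c : F} : X ∣ pencil b c R ↔ subst₂ b c R = 0 := by
  have h (Q : F[X][X]) : (pencil b c Q).coeff 0 = C (subst₂ b c Q) := by
    rw [coeff_zero_eq_eval_zero]
    have := DFunLike.congr_fun (algHom₂_ext
      (f := ((aeval (R := F[X]) (0 : F[X])).restrictScalars F).comp (pencil b c))
      (g := (CAlgHom (R := F)).comp (subst₂ b c)) (by simp) (by simp)) Q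
    simpa [aeval_def] using this
  rw [X_dvd_iff, h, C_eq_zero]

/-- Setting `s = 0` in `R(b + T, c + s T)`. -/
theorem map_pencil (b c : F) (R : F[X][X]) :
    (pencil b c R).map (evalRingHom 0) = taylor b (R.eval (C c)) := by
  have := DFunLike.congr_fun (algHom₂_ext (F := F)
    (f := (mapAlgHom (aeval (0 : F))).comp (pencil b c))
    (g := (taylorAlgHom b).comp ((aeval (R := F[X]) (C c : F[X])).restrictScalars F))
    (by simp [add_comm]) (by simp)) R
  simpa [aeval_def] using this

theorem sum_le_of_pow_dvd_taylor [Fintype F] {r : F[X]} (hr : r ≠ 0) (k : F → ℕ)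
    (hk : ∀ b, X ^ k b ∣ taylor b r) : ∑ b, k b ≤ r.natDegree := by
  classical
  have h (b : F) : k b ≤ r.roots.count b := by
    rw [count_roots, le_rootMultiplicity_iff hr]
    simpa [sub_eq_add_neg, taylor_taylor] using map_dvd (taylorAlgHom (-b)) (hk b)
  calc ∑ b, k b ≤ ∑ b, r.roots.count b := Finset.sum_le_sum fun b _ => h b
    _ = r.roots.card := Multiset.sum_count_eq_card fun a _ => Finset.mem_univ a
    _ ≤ r.natDegree := card_roots' r

/-- Setting s = 0 restricts to the line z = c without lowering multiplicities, so the root count in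
one variable applies on each of these lines. -/
theorem sum_multiplicity_le_of_eval_ne_zero [Fintype F] {R : F[X][X]} {D : ℕ}
    (hR : ∀ c, R.eval (C c) ≠ 0) (hD : ∀ b c, (pencil b c R).natDegree ≤ D) (k : F → F → ℕ)
    (hk : ∀ b c, X ^ k b c ∣ pencil b c R) : ∑ c, ∑ b, k b c ≤ Fintype.card F * D := by
  calc ∑ c, ∑ b, k b c ≤ ∑ _c : F, D := Finset.sum_le_sum fun c _ => ?_
    _ = Fintype.card F * D := by simp
  refine (sum_le_of_pow_dvd_taylor (hR c) (k · c) fun b => ?_).trans ?_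
  · simpa [← map_pencil] using map_dvd (mapRingHom (evalRingHom (0 : F))) (hk b c)
  · rw [← natDegree_taylor _ (0 : F), ← map_pencil]
    exact natDegree_map_le.trans (hD 0 c)

/-- The Schwartz–Zippel bound with multiplicities, for polynomials in two variables. -/
theorem sum_multiplicity_le [Fintype F] {R : F[X][X]} (hR : R ≠ 0) {D : ℕ}
    (hD : ∀ b c, (pencil b c R).natDegree ≤ D) (k : F → F → ℕ)
    (hk : ∀ b c, X ^ k b c ∣ pencil b c R) : ∑ c, ∑ b, k b c ≤ Fintype.card F * D := by
  classical
  induction D using Nat.strong_induction_on generalizing R k with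
  | _ D IH
  by_cases hroot : ∀ c, R.eval (C c) ≠ 0
  · exact sum_multiplicity_le_of_eval_ne_zero hroot hD k hk
  push Not at hroot
  obtain ⟨c₀, hc₀⟩ := hroot
  -- Splitting off z − c₀ lowers the degree by one. It costs multiplicity at most one, and only at
  -- the |F| points with z = c₀; hence the induction on D.
  obtain ⟨R', rfl⟩ := dvd_iff_isRoot.mpr hc₀
  have hR' : R' ≠ 0 := right_ne_zero_of_mul hR
  have hpencil (b c : F) : pencil b c ((X - C (C c₀)) * R') =
      (C X * X + C (C (c - c₀))) * pencil b c R' := by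
    rw [map_mul, map_sub (pencil b c), pencil_X, pencil_C_C, C_sub, C_sub]
    ring
  have hdeg (b c : F) : (pencil b c ((X - C (C c₀)) * R')).natDegree =
      1 + (pencil b c R').natDegree := by
    rw [hpencil, natDegree_mul, natDegree_linear X_ne_zero]
    · intro h
      have := natDegree_linear (b := C (c - c₀)) (X_ne_zero (R := F))
      rw [h, natDegree_zero] at this
      omega
    · exact (map_ne_zero_iff _ (pencil_injective b c)).mpr hR'
  obtain ⟨D, rfl⟩ : ∃ D', D = D' + 1 := by
    have := hD 0 0
    rw [hdeg] at this
    exact ⟨D - 1, by omega⟩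
  have ih := IH D (by omega) hR' (fun b c => by have := hD b c; rw [hdeg] at this; omega)
    (fun b c => if c = c₀ then k b c - 1 else k b c) fun b c => ?_
  · have hle (c : F) : ∑ b, k b c ≤ (∑ b, if c = c₀ then k b c - 1 else k b c) +
        if c = c₀ then Fintype.card F else 0 := by
      split_ifs
      · rw [← Finset.card_univ, Finset.card_eq_sum_ones, ← Finset.sum_add_distrib]
        exact Finset.sum_le_sum fun b _ => by omega
      · simp
    calc ∑ c, ∑ b, k b c ≤ _ := Finset.sum_le_sum fun c _ => hle c
      _ ≤ Fintype.card F * (D + 1) := by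
        rw [Finset.sum_add_distrib, Finset.sum_ite_eq' Finset.univ, if_pos (Finset.mem_univ _)]
        linarith
  · have hkbc := hk b c
    rw [hpencil] at hkbc
    split_ifs with hc
    · subst hc
      by_cases hz : k b c = 0
      · simp [hz]
      · obtain ⟨m, hm⟩ := Nat.exists_eq_add_one_of_ne_zero hz
        rw [hm] at hkbc ⊢
        rw [sub_self, C_0, C_0, add_zero, pow_succ', mul_comm (C (X : F[X])) X, mul_assoc,
          mul_dvd_mul_iff_left X_ne_zero] at hkbc
        refine prime_X.pow_dvd_of_dvd_mul_left _ ?_ hkbc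
        simp [X_dvd_iff]
    · refine prime_X.pow_dvd_of_dvd_mul_left _ ?_ hkbc
      simp [X_dvd_iff, sub_eq_zero, hc]

/-- A nonzero polynomial of total degree at most `D` has at most `|F| D` zeros. -/
theorem card_zeros_le [Fintype F] [DecidableEq F] {R : F[X][X]} (hR : R ≠ 0) {D : ℕ}
    (hD : TotalDegreeLE D R) :
    (Finset.univ.filter fun q : F × F => subst₂ q.1 q.2 R = 0).card ≤ Fintype.card F * D := by
  have := sum_multiplicity_le hR (natDegree_pencil_le hD)
    (fun b c => if subst₂ b c R = 0 then 1 else 0) fun b c => ?_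
  · rw [Finset.sum_comm, ← Fintype.sum_prod_type'] at this
    rwa [Finset.card_filter]
  · split_ifs with h
    · simpa using X_dvd_pencil_iff.mpr h
    · simp

end Bivariate

/-! ### Weights of the coefficients, and the degree of the resultant -/

section Weight

variable {R : Type*} [CommRing R]

/-- The coefficient of `x ^ m` has degree at most `k + m`, for all `m`. -/
def WeightLE (k : ℕ) (h : R[X][X]) : Prop :=
  ∀ m, (h.coeff m).natDegree ≤ k + m

theorem WeightLE.mono {k l : ℕ} (hkl : k ≤ l) {h : R[X][X]} (hh : WeightLE k h) : WeightLE l h :=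
  fun m => (hh m).trans (by omega)

theorem WeightLE.add {k : ℕ} {h h' : R[X][X]} (hh : WeightLE k h) (hh' : WeightLE k h') :
    WeightLE k (h + h') := fun m => by
  rw [coeff_add]
  exact natDegree_add_le_of_degree_le (hh m) (hh' m)

theorem WeightLE.sum {ι : Type*} {s : Finset ι} {k : ℕ} {h : ι → R[X][X]}
    (hh : ∀ i ∈ s, WeightLE k (h i)) : WeightLE k (∑ i ∈ s, h i) := fun m => by
  rw [finsetSum_coeff]
  exact natDegree_sum_le_of_forall_le _ _ fun i hi => hh i hi m

theorem WeightLE.mul {k l : ℕ} {h h' : R[X][X]} (hh : WeightLE k h) (hh' : WeightLE l h') :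
    WeightLE (k + l) (h * h') := fun m => by
  rw [coeff_mul]
  refine natDegree_sum_le_of_forall_le _ _ fun ij hij => ?_
  have := Finset.HasAntidiagonal.mem_antidiagonal.mp hij
  have h1 := hh ij.1
  have h2 := hh' ij.2
  exact natDegree_mul_le.trans (by omega)

theorem weightLE_C {k : ℕ} {q : R[X]} (hq : q.natDegree ≤ k) : WeightLE k (C q) := fun m => by
  rw [coeff_C]
  split_ifs
  · omega
  · simp

theorem weightLE_X : WeightLE 0 (X : R[X][X]) := fun m => by
  rw [coeff_X]
  split_ifs <;> simp

theorem WeightLE.pow {k : ℕ} {h : R[X][X]} (hh : WeightLE k h) (n : ℕ) :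
    WeightLE (n * k) (h ^ n) := by
  induction n with
  | zero => simpa using weightLE_C (k := 0) (q := (1 : R[X])) (by simp)
  | succ n ih =>
    rw [pow_succ, Nat.succ_mul]
    exact ih.mul hh

/-- If the degrees of the entries of a matrix are bounded by `u i - w j`, then the degree of the
determinant is bounded by `∑ u - ∑ w`. -/
theorem natDegree_det_le {n : Type*} [Fintype n] [DecidableEq n] (M : Matrix n n R[X])
    (u w : n → ℕ) (h : ∀ i j, M i j ≠ 0 → (M i j).natDegree + w j ≤ u i) :
    M.det.natDegree ≤ ∑ i, u i - ∑ j, w j := by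
  rw [Matrix.det_apply]
  refine natDegree_sum_le_of_forall_le _ _ fun τ _ => ?_
  refine (natDegree_smul_le _ _).trans ?_
  -- A Leibniz term without zero entries has degree at most ∑ (u (τ i) − w i), which is independent
  -- of τ.
  by_cases hz : ∃ i, M (τ i) i = 0
  · obtain ⟨i, hi⟩ := hz
    rw [Finset.prod_eq_zero (f := fun i => M (τ i) i) (Finset.mem_univ i) hi]
    simp
  · push Not at hz
    have h1 : ∑ i, ((M (τ i) i).natDegree + w i) ≤ ∑ i, u (τ i) :=
      Finset.sum_le_sum fun i _ => h _ _ (hz i)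
    rw [Finset.sum_add_distrib, Equiv.sum_comp τ u] at h1
    exact (natDegree_prod_le _ _).trans (by omega)

/-- The degree of the resultant of two polynomials of bounded weights. -/
theorem natDegree_resultant_le {f g : R[X][X]} {k l : ℕ} (hf : WeightLE k f) (hg : WeightLE l g)
    (m n : ℕ) : (resultant f g m n).natDegree ≤ m * n + n * k + m * l := by
  -- The Sylvester entry (i, j) is a coefficient of index i − j: of g in the first m columns, of f
  -- in the other n. The column weights j + k and j + l bring both bounds to i + k + l.
  refine (natDegree_det_le (sylvester f g m n) (fun i => i + (k + l))
    (Fin.addCases (fun j => j + k) (fun j => j + l)) fun i j hij => ?_).trans ?_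
  · induction j using Fin.addCases with
    | left j =>
      simp only [sylvester, Matrix.of_apply, Fin.addCases_left] at hij ⊢
      split_ifs at hij ⊢ with hmem
      · have := hg (i - j)
        have := hmem.1
        omega
      · exact absurd rfl hij
    | right j =>
      simp only [sylvester, Matrix.of_apply, Fin.addCases_right] at hij ⊢
      split_ifs at hij ⊢ with hmem
      · have := hf (i - j)
        have := hmem.1
        omega
      · exact absurd rfl hij
  · rw [Fin.sum_univ_add]
    simp only [Fin.addCases_left, Fin.addCases_right, Finset.sum_add_distrib, Finset.sum_const,
      Finset.card_univ, Fintype.card_fin, smul_eq_mul, Fin.sum_univ_add, Fin.val_castAdd,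
      Fin.val_natAdd]
    rw [Nat.sub_le_iff_le_add]
    apply le_of_eq
    ring

/-- The resultant with formal degrees is invariant under translations. -/
theorem resultant_taylor' {f g : R[X]} (r : R) {m n : ℕ} (hm : f.natDegree = m)
    (hn : g.natDegree ≤ n) : resultant (taylor r f) (taylor r g) m n = resultant f g m n := by
  obtain ⟨k, rfl⟩ := Nat.exists_eq_add_of_le hn
  -- Surplus formal degree of g only contributes powers of the leading coefficient of f, which a
  -- translation preserves.
  have h1 := resultant_add_right_deg f g m g.natDegree k le_rfl
  have h2 := resultant_add_right_deg (taylor r f) (taylor r g) m g.natDegree k (by simp)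
  have h3 := resultant_taylor f g r
  have h4 : (taylor r f).coeff m = f.coeff m := by
    subst hm
    have := leadingCoeff_taylor (f := f) r
    rwa [leadingCoeff, leadingCoeff, natDegree_taylor] at this
  rw [natDegree_taylor, natDegree_taylor, hm] at h3
  rw [h1, h2, h3, h4]

end Weight

/-! ### Degree bounds from the substitution (x + s, b + T, c + sT) -/

section Graded

variable {F : Type*} [Field F]

theorem subst₂_mem {S : Type*} [CommRing S] [Algebra F S] (W : Subalgebra F S) {y z : S}
    (hy : y ∈ W) (hz : z ∈ W) (q : F[X][X]) : subst₂ y z q ∈ W := by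
  have := map_subst₂ W.val ⟨y, hy⟩ ⟨z, hz⟩ q
  rw [← show _ = subst₂ y z q from this]
  exact Subtype.property _

/-- The polynomials of weight `0`. -/
def weightZero : Subalgebra F F[X][X][X] where
  carrier := {h | WeightLE 0 h}
  mul_mem' h h' := h.mul h'
  add_mem' h h' := h.add h'
  algebraMap_mem' a := weightLE_C (by simp)

/-- The inner variables land in the subalgebra of weight zero, so weight arises only from the at
most k factors u. -/
theorem weightLE_subst₃ {u v w : F[X][X][X]} (hu : WeightLE 1 u) (hv : WeightLE 0 v)
    (hw : WeightLE 0 w) {g : F[X][X][X]} {k : ℕ} (hk : g.natDegree ≤ k) :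
    WeightLE k (subst₃ u v w g) := by
  rw [g.as_sum_range_C_mul_X_pow' (Nat.lt_succ_of_le hk), map_sum]
  refine WeightLE.sum fun j hj => ?_
  rw [map_mul, map_pow, subst₃_C, subst₃_X]
  have h : WeightLE 0 (subst₂ v w (g.coeff j)) :=
    subst₂_mem (S := F[X][X][X]) weightZero hv hw (g.coeff j)
  exact (h.mul (hu.pow j)).mono (by have := Finset.mem_range.mp hj; omega)

theorem taylor_map_pencil (b c : F) (f : F[X][X][X]) :
    taylor (C X) (f.map (pencil b c : F[X][X] →+* F[X][X])) =
      subst₃ (X + C (C X)) (C (C (C b) + X)) (C (C (C c) + C X * X)) f := by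
  have h := map_subst₂_eq_subst₃ (S := F[X][X]) (C (C b) + X) (C (C c) + C X * X) f
  have h' := map_subst₃ (S' := F[X][X][X]) ((taylorAlgHom (R := F[X][X]) (C X)).restrictScalars F) X
    (C (C (C b) + X)) (C (C (C c) + C X * X)) f
  rw [pencil, h]
  simpa using h'

/-- If `f(y, x, x y - z)` has degree at most `k` in `x`, then the coefficient of `x ^ m` in
`f(x + s, b + T, c + s T)` has degree at most `k + m` in `T`. -/
theorem weightLE_taylor_pencil {f : F[X][X][X]} {k : ℕ} (hk : (flip₃ f).natDegree ≤ k) (b c : F) :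
    WeightLE k (taylor (C X) (f.map (pencil b c : F[X][X] →+* F[X][X]))) := by
  -- The sT of the moving line cancels against the translation of x by s. The remaining T occurs
  -- only as xT, which has weight 0.
  have h : (X + C (C X)) * C (C (C b) + X) - C (C (C c) + C X * X) =
      X * C (C (C b)) + C X * X + C (C (X * C b - C c)) := by
    simp only [C_add, C_mul, C_sub]
    ring
  rw [taylor_map_pencil, ← flip₃_flip₃ f, subst₃_flip₃, h]
  refine weightLE_subst₃ (weightLE_C (by compute_degree))
    (weightLE_X.add (weightLE_C (natDegree_C _).le)) ?_ hk
  refine ((weightLE_X.mul (weightLE_C (natDegree_C _).le)).add fun m => ?_).add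
    (weightLE_C (natDegree_C _).le)
  rw [coeff_C_mul, coeff_X]
  split_ifs with hm
  · simp [← hm]
  · simp

theorem natDegree_coeff_taylor_le {R : Type*} [CommRing R] {h : R[X][X]} {N : ℕ}
    (hN : ∀ m, (h.coeff m).natDegree ≤ N) (r : R) (m : ℕ) :
    ((taylor (C r) h).coeff m).natDegree ≤ N := by
  rw [taylor_coeff, eval_eq_sum_range]
  refine natDegree_sum_le_of_forall_le _ _ fun i _ => ?_
  rw [hasseDeriv_coeff, ← C_pow, ← C_eq_natCast, mul_comm, ← mul_assoc, ← C_mul]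
  exact (natDegree_C_mul_le _ _).trans (hN _)

/-- The coefficients of `f` have total degree at most
`deg_x f(x, y, z) + deg_x f(y, x, x y - z)`. -/
theorem totalDegreeLE_coeff {f : F[X][X][X]} {k l : ℕ} (hk : f.natDegree ≤ k)
    (hl : (flip₃ f).natDegree ≤ l) (m : ℕ) : TotalDegreeLE (k + l) (f.coeff m) := by
  apply totalDegreeLE_of_natDegree_pencil
  have h := weightLE_taylor_pencil hl (0 : F) 0
  set g := f.map (pencil (0 : F) 0 : F[X][X] →+* F[X][X]) with hg
  -- Only the coefficients of x^i with i ≤ k are nonzero, so all have degree at most l + k in T.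
  -- Translating back by −s does not involve T and keeps this bound.
  have h' := natDegree_coeff_taylor_le (h := taylor (C X) g) (N := k + l) (fun i => ?_) (-X) m
  · rw [taylor_taylor, C_neg, neg_add_cancel, taylor_zero, hg, coeff_map] at h'
    exact h'
  · by_cases hi : i ≤ k
    · exact (h i).trans (by omega)
    · rw [coeff_eq_zero_of_natDegree_lt]
      · simp
      · rw [natDegree_taylor]
        exact natDegree_map_le.trans_lt (by omega)

/-- A nonzero polynomial vanishes identically on few lines in the direction of `x`. -/
theorem card_lineX_eq_zero_le [Fintype F] [DecidableEq F] {f : F[X][X][X]} (hf : f ≠ 0) {k l : ℕ}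
    (hk : f.natDegree ≤ k) (hl : (flip₃ f).natDegree ≤ l) :
    (Finset.univ.filter fun q : F × F => lineX f q.1 q.2 = 0).card ≤ Fintype.card F * (k + l) := by
  -- On such a line every coefficient vanishes, in particular the leading one, a nonzero polynomial
  -- in y, z of total degree at most k + l.
  refine le_trans (Finset.card_le_card ?_)
    (card_zeros_le (leadingCoeff_ne_zero.mpr hf) (totalDegreeLE_coeff hk hl f.natDegree))
  intro q hq
  simp only [Finset.mem_filter, Finset.mem_univ, true_and] at hq ⊢
  rw [leadingCoeff, ← coeff_lineX, hq, coeff_zero]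

end Graded

/-! ### Divisibility on lines -/

section Divisibility

/-- A kernel vector of the Sylvester matrix is a relation fq + gp = 0 with deg p < deg f.
Coprimality gives f ∣ p, hence p = 0 and q = 0. -/
theorem resultant_ne_zero_of_isRelPrime {R : Type*} [CommRing R] [IsDomain R]
    [UniqueFactorizationMonoid R] {f g : R[X]} (hf : f ≠ 0) (hfg : IsRelPrime f g) {n : ℕ}
    (hn : g.natDegree ≤ n) : resultant f g f.natDegree n ≠ 0 := by
  intro h0
  set m := f.natDegree with hm
  obtain ⟨v, hv, hv0⟩ := Matrix.exists_mulVec_eq_zero_iff.mpr h0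
  let b₁ := ((degreeLT.basis R m).prod (degreeLT.basis R n)).reindex finSumFinEquiv
  let b₂ := degreeLT.basis R (m + n)
  have hx : sylvesterMap f g hm.ge hn (b₁.equivFun.symm v) = 0 := by
    have := LinearMap.toMatrix_mulVec_repr b₁ b₂ (sylvesterMap f g hm.ge hn) (b₁.equivFun.symm v)
    rw [toMatrix_sylvesterMap'] at this
    have h1 : ⇑(b₁.repr (b₁.equivFun.symm v)) = v := b₁.equivFun.apply_symm_apply v
    rw [h1, hv0] at this
    apply b₂.repr.injective
    ext i
    simpa using (congrFun this i).symm
  have hx0 : b₁.equivFun.symm v ≠ 0 := (LinearEquiv.map_ne_zero_iff _).mpr hv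
  generalize b₁.equivFun.symm v = w at hx hx0
  obtain ⟨⟨p, hp⟩, ⟨q, hq⟩⟩ := w
  have heq : f * q + g * p = 0 := congrArg Subtype.val hx
  have hdvd : f ∣ g * p := ⟨-q, by linear_combination heq⟩
  have hp0 : p = 0 := by
    by_contra hp0
    have := natDegree_le_of_dvd (hfg.dvd_of_dvd_mul_left hdvd) hp0
    rw [mem_degreeLT, degree_eq_natDegree hp0] at hp
    have := Nat.cast_lt.mp hp
    omega
  subst hp0
  have hq0 : q = 0 := by simpa [hf] using heq
  subst hq0
  exact hx0 rfl

variable {F : Type*} [Field F]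

/-- If `f` divides `g` on the line over `(b, c)`, then the resultant of `f` and `g` vanishes at
`(b, c)` to the order `m`. -/
theorem X_pow_dvd_pencil_resultant {f g : F[X][X][X]} {m n : ℕ} (hf : f.natDegree ≤ m) {b c : F}
    {q : F[X]} (hq : q.natDegree + m ≤ n) (h : lineX g b c = lineX f b c * q) :
    X ^ m ∣ pencil b c (resultant f g m n) := by
  set k : F[X][X] →+* F[X][X] := (pencil b c : F[X][X] →+* F[X][X]) with hk
  have hres : pencil b c (resultant f g m n) = resultant (f.map k) (g.map k) m n := by
    rw [resultant_map_map]
    rfl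
  -- The quotient on the line, read as a polynomial that does not involve y and z. After the pencil
  -- substitution, g ≡ f q' modulo T.
  set q' : F[X][X][X] := q.map (C.comp C) with hq'
  have hdvd : C X ∣ g.map k - f.map k * q' := by
    rw [C_dvd_iff_dvd_coeff]
    intro i
    have h1 : g.map k - f.map k * q' = (g - f * q').map k := by
      have hcomp : k.comp (C.comp C) = (C.comp C : F →+* F[X][X]) :=
        RingHom.ext fun a => by simp [hk]
      rw [Polynomial.map_sub, Polynomial.map_mul, hq', Polynomial.map_map, hcomp]
    have h2 : lineX q' b c = q := by
      have hcomp : (subst₂ (F := F) b c : F[X][X] →+* F).comp (C.comp C) = RingHom.id F :=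
        RingHom.ext fun a => by simp
      rw [lineX_eq_map, hq', Polynomial.map_map, hcomp, Polynomial.map_id]
    have h3 : lineX (g - f * q') b c = 0 := by
      rw [lineX, map_sub (subst₃ (F := F) X (C b) (C c)), ← lineX, ← lineX, lineX_mul, h2, h,
        sub_self]
    rw [h1, coeff_map]
    refine X_dvd_pencil_iff.mpr ?_
    rw [← coeff_lineX, h3, coeff_zero]
  obtain ⟨r, hr⟩ := hdvd
  have : g.map k = C X * r + f.map k * q' := by rw [← hr]; ring
  -- Subtracting f q' from g leaves the resultant unchanged, since q has degree at most n − m. The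
  -- factor T then comes out of each of the m columns belonging to g.
  rw [hres, this, resultant_add_mul_right, resultant_C_mul_right]
  · exact dvd_mul_right _ _
  · exact (Nat.add_le_add_right natDegree_map_le m).trans hq
  · exact natDegree_map_le.trans hf

/-- If `f` and `g` are relatively prime, then there are only few lines in the direction of `x` on
which `f` divides `g`. -/
theorem card_dvd_lineX_le [Fintype F] [DecidableEq F] {f g : F[X][X][X]} (hf : f ≠ 0)
    (hfg : IsRelPrime f g) {k l dx dy : ℕ} (hk : f.natDegree = k) (hl : (flip₃ f).natDegree ≤ l)
    (hkl : l ≤ k) (hk0 : 0 < k) (hgk : g.natDegree ≤ k + dx) (hgl : (flip₃ g).natDegree ≤ l + dy)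
    (s : Finset (F × F))
    (hs : ∀ q ∈ s, ∃ r : F[X], r.natDegree ≤ dx ∧ lineX g q.1 q.2 = lineX f q.1 q.2 * r) :
    s.card ≤ Fintype.card F * (k + 2 * l + 2 * dx + dy) := by
  have hR := resultant_ne_zero_of_isRelPrime hf hfg hgk
  rw [hk] at hR
  have hdeg (b c : F) : (pencil b c (resultant f g k (k + dx))).natDegree ≤
      k * (k + 2 * l + 2 * dx + dy) := by
    have hmap : pencil b c (resultant f g k (k + dx)) =
        resultant (taylor (C X) (f.map (pencil b c : F[X][X] →+* F[X][X])))
          (taylor (C X) (g.map (pencil b c : F[X][X] →+* F[X][X]))) k (k + dx) := by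
      rw [resultant_taylor', resultant_map_map]
      · rfl
      · exact (natDegree_map_eq_of_injective (f := (pencil b c : F[X][X] →+* F[X][X]))
          (pencil_injective b c) f).trans hk
      · exact natDegree_map_le.trans hgk
    rw [hmap]
    refine (natDegree_resultant_le (weightLE_taylor_pencil hl b c) (weightLE_taylor_pencil hgl b c)
      k (k + dx)).trans ?_
    -- The bound is k(k + dx) + (k + dx)l + k(l + dy). Using l·dx ≤ k·dx makes k a common factor,
    -- which later cancels against the multiplicity k.
    nlinarith [Nat.mul_le_mul_right dx hkl]
  have := sum_multiplicity_le hR hdeg (fun b c => if (b, c) ∈ s then k else 0) fun b c => ?_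
  · rw [Finset.sum_comm,
      ← Fintype.sum_prod_type' (f := fun b c => if (b, c) ∈ s then k else 0)] at this
    simp only [Prod.mk.eta, Finset.sum_ite_mem, Finset.univ_inter, Finset.sum_const,
      smul_eq_mul] at this
    refine Nat.le_of_mul_le_mul_left ?_ hk0
    linarith
  · split_ifs with hq
    · obtain ⟨r, hr, h⟩ := hs _ hq
      exact X_pow_dvd_pencil_resultant hk.le (by omega) h
    · simp

end Divisibility

/-! ### Reed–Solomon codes -/

section ReedSolomon

variable {F : Type*} [Field F]

theorem reedSolomon_mono {d d' : ℕ} (h : d ≤ d') {f : F → F} (hf : f ∈ reedSolomon F d) :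
    f ∈ reedSolomon F d' :=
  let ⟨P, hP, hf⟩ := hf
  ⟨P, hP.trans h, hf⟩

theorem reedSolomon_sub {d : ℕ} {f g : F → F} (hf : f ∈ reedSolomon F d)
    (hg : g ∈ reedSolomon F d) : (fun a => f a - g a) ∈ reedSolomon F d := by
  obtain ⟨P, hP, hf⟩ := hf
  obtain ⟨Q, hQ, hg⟩ := hg
  exact ⟨P - Q, (natDegree_sub_le_of_le hP hQ).trans (max_self d).le, fun a => by simp [hf, hg]⟩

theorem reedSolomon_translate {d : ℕ} {f : F → F} (hf : f ∈ reedSolomon F d) (r : F) :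
    (fun a => f (r + a)) ∈ reedSolomon F d := by
  obtain ⟨P, hP, hf⟩ := hf
  exact ⟨taylor r P, by rwa [natDegree_taylor], fun a => by
    simp only [hf, taylor_eval, add_comm]⟩

/-- A polynomial of degree less than `|F|` is determined by its values. -/
theorem eq_of_eval_eq [Fintype F] {P Q : F[X]} {n : ℕ} (hn : n < Fintype.card F)
    (hP : P.natDegree ≤ n) (hQ : Q.natDegree ≤ n) (h : ∀ a, P.eval a = Q.eval a) : P = Q := by
  refine Polynomial.eq_of_natDegree_lt_card_of_eval_eq P Q Function.injective_id h ?_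
  exact (max_le hP hQ).trans_lt hn

theorem eval₃_mem_reedSolomon {f : F[X][X][X]} {d : ℕ} (hd : f.natDegree ≤ d) (b c : F) :
    (fun a => eval₃ f a b c) ∈ reedSolomon F d :=
  ⟨lineX f b c, (natDegree_lineX_le f b c).trans hd, fun a => (eval_lineX f a b c).symm⟩

/-- The values of a polynomial of bounded degrees form a word of the code. -/
theorem eval₃_mem_skewCode {f : F[X][X][X]} {k l : ℕ} (hk : f.natDegree ≤ k)
    (hl : (flip₃ f).natDegree ≤ l) :
    (fun q : F × F × F => eval₃ f q.1 q.2.1 q.2.2) ∈ skewCode F k l := by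
  refine ⟨fun b c => eval₃_mem_reedSolomon hk b c, fun a c => ?_⟩
  have := eval₃_mem_reedSolomon hl a (-c)
  simpa only [eval₃_flip₃, sub_neg_eq_add, mul_comm _ a] using this

end ReedSolomon

/-! ### The words of the code are polynomials -/

section Representation

/-! ### Uniform degree bounds on coefficients -/

section Coefficients

variable {R : Type*} [CommRing R]

/-- All coefficients have degree at most `n`. -/
def CoeffDegreeLE (n : ℕ) (h : R[X][X]) : Prop :=
  ∀ m, (h.coeff m).natDegree ≤ n

theorem CoeffDegreeLE.mul {k l : ℕ} {h h' : R[X][X]} (hh : CoeffDegreeLE k h)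
    (hh' : CoeffDegreeLE l h') : CoeffDegreeLE (k + l) (h * h') := fun m => by
  rw [coeff_mul]
  refine natDegree_sum_le_of_forall_le _ _ fun ij _ => ?_
  exact natDegree_mul_le.trans (Nat.add_le_add (hh _) (hh' _))

theorem coeffDegreeLE_C {k : ℕ} {q : R[X]} (hq : q.natDegree ≤ k) : CoeffDegreeLE k (C q) :=
  fun m => by
    rw [coeff_C]
    split_ifs
    · exact hq
    · simp

theorem coeffDegreeLE_X : CoeffDegreeLE 0 (X : R[X][X]) := fun m => by
  rw [coeff_X]
  split_ifs <;> simp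

theorem CoeffDegreeLE.add {k : ℕ} {h h' : R[X][X]} (hh : CoeffDegreeLE k h)
    (hh' : CoeffDegreeLE k h') : CoeffDegreeLE k (h + h') := fun m => by
  rw [coeff_add]
  exact natDegree_add_le_of_degree_le (hh m) (hh' m)

theorem CoeffDegreeLE.sub {k : ℕ} {h h' : R[X][X]} (hh : CoeffDegreeLE k h)
    (hh' : CoeffDegreeLE k h') : CoeffDegreeLE k (h - h') := fun m => by
  rw [coeff_sub]
  exact (natDegree_sub_le_of_le (hh m) (hh' m)).trans (max_self k).le

theorem CoeffDegreeLE.pow {k : ℕ} {h : R[X][X]} (hh : CoeffDegreeLE k h) (n : ℕ) :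
    CoeffDegreeLE (n * k) (h ^ n) := by
  induction n with
  | zero => simpa using coeffDegreeLE_C (k := 0) (q := (1 : R[X])) (by simp)
  | succ n ih =>
    rw [pow_succ, Nat.succ_mul]
    exact ih.mul hh

end Coefficients

variable {F : Type*} [Field F]

theorem mem_of_monomials₃ (Q : Submodule F F[X][X][X]) (f : F[X][X][X])
    (h : ∀ i j m, ((f.coeff m).coeff j).coeff i ≠ 0 →
      (C (C X ^ i * X ^ j) * X ^ m : F[X][X][X]) ∈ Q) :
    f ∈ Q := by
  rw [f.as_sum_support_C_mul_X_pow]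
  refine Q.sum_mem fun m _ => ?_
  exact mem_of_monomials₂ (Q.comap ((LinearMap.mulRight F (X ^ m)).comp
    (CAlgHom (R := F) (A := F[X][X])).toLinearMap)) (f.coeff m) fun i j hij => h i j m hij

theorem TotalDegreeLE.add {N : ℕ} {R R' : F[X][X]} (h : TotalDegreeLE N R)
    (h' : TotalDegreeLE N R') : TotalDegreeLE N (R + R') := by
  intro i j hij
  by_contra hN
  rw [coeff_add, coeff_add, not_not.mp (mt (h i j) hN), not_not.mp (mt (h' i j) hN)] at hij
  simp at hij

theorem TotalDegreeLE.smul {N : ℕ} {R : F[X][X]} (h : TotalDegreeLE N R) (a : F) :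
    TotalDegreeLE N (a • R) := by
  intro i j hij
  rw [coeff_smul, coeff_smul] at hij
  exact h i j (right_ne_zero_of_smul hij)

theorem totalDegreeLE_zero (N : ℕ) : TotalDegreeLE N (0 : F[X][X]) := by
  intro i j hij
  simp at hij

/-- The monomial x^m y^i z^j is sent to y^m x^i (xy − z)^j, of degree i + j in x. -/
theorem natDegree_flip₃_le {f : F[X][X][X]} {N : ℕ} (hN : ∀ m, TotalDegreeLE N (f.coeff m)) :
    (flip₃ f).natDegree ≤ N := by
  have := mem_of_monomials₃
    (((degreeLE F[X][X] N).restrictScalars F).comap (flip₃ (F := F)).toLinearMap) f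
    fun i j m hij => ?_
  · simpa [mem_degreeLE, natDegree_le_iff_degree_le] using this
  · have h1 : (X * C (C X) - C X : F[X][X][X]).natDegree ≤ 1 := by compute_degree
    have h2 := natDegree_pow_le_of_le j h1
    have h3 := natDegree_mul_le (p := (X ^ i : F[X][X][X])) (q := (X * C (C X) - C X) ^ j)
    have h4 := natDegree_mul_C_le (X ^ i * (X * C (C X) - C X : F[X][X][X]) ^ j) (C X ^ m)
    rw [natDegree_X_pow] at h3
    have h5 := hN m i j hij
    simp only [Submodule.mem_comap, Submodule.restrictScalars_mem, AlgHom.toLinearMap_apply,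
      map_mul, map_pow, mem_degreeLE, ← natDegree_le_iff_degree_le, flip₃_X, flip₃_C_X,
      flip₃_C_C_X] at h4 ⊢
    omega

/-- In y^m x^i (xy − z)^j each coefficient of a power of x has total degree at most m + j; applying
the pencil turns this into a degree in T. -/
theorem totalDegreeLE_coeff_flip₃ {f : F[X][X][X]} {k N : ℕ} (hk : f.natDegree ≤ k)
    (hN : ∀ m, TotalDegreeLE N (f.coeff m)) (m : ℕ) :
    TotalDegreeLE (k + N) ((flip₃ f).coeff m) := by
  let L : F[X][X][X] →ₐ[F] F[X][X][X] := (mapAlgHom (pencil (0 : F) 0)).comp flip₃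
  let Q : Submodule F F[X][X][X] :=
    { carrier := {f | CoeffDegreeLE (k + N) (L f)}
      zero_mem' := fun m => by simp
      add_mem' := fun h h' => by
        rw [Set.mem_ofPred_eq, map_add]
        exact h.add h'
      smul_mem' := fun a f h m => by
        rw [map_smul, coeff_smul]
        exact (natDegree_smul_le _ _).trans (h m) }
  have hmem : f ∈ Q := by
    refine mem_of_monomials₃ Q f fun i j m hij => ?_
    have h1 : CoeffDegreeLE 1 (C X * X - C (C X * X) : F[X][X][X]) := by
      refine CoeffDegreeLE.sub ((coeffDegreeLE_C (k := 1) ?_).mul coeffDegreeLE_X)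
        (coeffDegreeLE_C ?_)
      · simp
      · compute_degree
    have h2 : CoeffDegreeLE 1 (C X : F[X][X][X]) := coeffDegreeLE_C (by simp)
    have h3 : L (C (C X ^ i * X ^ j) * X ^ m) = X ^ i * (C X * X - C (C X * X)) ^ j * C X ^ m := by
      have hy : L (C (C X)) = X := by simp [L]
      have hx : L X = C X := by simp [L]
      have hz : L (C X) = C X * X - C (C X * X) := by simp [L]
      rw [map_mul, C_mul, C_pow, C_pow, map_mul, map_pow, map_pow, map_pow, hx, hy, hz]
    have h4 := ((coeffDegreeLE_X.pow i).mul (h1.pow j)).mul (h2.pow m)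
    rw [← h3] at h4
    have h5 := hN m i j hij
    have h6 : m ≤ f.natDegree := le_natDegree_of_ne_zero fun h => by simp [h] at hij
    exact fun n => (h4 n).trans (by omega)
  have := hmem m
  apply totalDegreeLE_of_natDegree_pencil
  simpa [L] using this

theorem totalDegreeLE_C_mul {i n N : ℕ} (h : i + n ≤ N) {S : F[X]} (hS : S.natDegree ≤ n) :
    TotalDegreeLE N (C X ^ i * S.map C : F[X][X]) := by
  intro i' j hij
  rw [← C_pow, coeff_C_mul, coeff_map, coeff_mul_C, coeff_X_pow] at hij
  have h1 : i' = i := by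
    by_contra hne
    simp [hne] at hij
  have h2 : j ≤ S.natDegree := le_natDegree_of_ne_zero (right_ne_zero_of_mul hij)
  omega

/-- Faulhaber's recursion: expand (c + 1)^(j+1) − c^(j+1), remove the lower powers of c by
induction, and divide by j + 1, which is invertible modulo p. -/
theorem exists_antidifference {p : ℕ} [Fact p.Prime] {j : ℕ} (hj : j + 1 < p) :
    ∃ S : (ZMod p)[X], S.natDegree ≤ j + 1 ∧ ∀ c, S.eval (c + 1) - S.eval c = c ^ j := by
  induction j using Nat.strong_induction_on with
  | _ j ih
  choose! S hS hSc using fun i (hi : i < j) => ih i hi (by omega)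
  have hne : ((j + 1 : ℕ) : ZMod p) ≠ 0 := by
    rw [Ne, ZMod.natCast_eq_zero_iff]
    exact fun h => absurd (Nat.le_of_dvd (by omega) h) (by omega)
  refine ⟨C (((j + 1 : ℕ) : ZMod p)⁻¹) *
    (X ^ (j + 1) - ∑ i ∈ Finset.range j, C ((j + 1).choose i : ZMod p) * S i), ?_, fun c => ?_⟩
  · refine (natDegree_C_mul_le _ _).trans ((natDegree_sub_le_of_le (natDegree_X_pow_le _)
      (natDegree_sum_le_of_forall_le _ _ fun i hi => ?_)).trans (max_self _).le)
    have hi := Finset.mem_range.mp hi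
    exact (natDegree_C_mul_le _ _).trans ((hS i hi).trans (by omega))
  · have h1 : ∑ i ∈ Finset.range j, ((j + 1).choose i : ZMod p) * (S i).eval (c + 1) -
        ∑ i ∈ Finset.range j, ((j + 1).choose i : ZMod p) * (S i).eval c =
        ∑ i ∈ Finset.range j, c ^ i * ((j + 1).choose i : ZMod p) := by
      rw [← Finset.sum_sub_distrib]
      refine Finset.sum_congr rfl fun i hi => ?_
      rw [← mul_sub, hSc i (Finset.mem_range.mp hi), mul_comm]
    have h2 := add_pow c 1 (j + 1)
    rw [Finset.sum_range_succ, Finset.sum_range_succ] at h2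
    simp only [one_pow, mul_one, Nat.choose_self, Nat.cast_one, Nat.choose_succ_self_right] at h2
    simp only [eval_mul, eval_C, eval_sub, eval_pow, eval_X, eval_finsetSum]
    rw [← mul_sub, inv_mul_eq_iff_eq_mul₀ hne]
    linear_combination h2 - h1

/-- The forward difference in `z` has a right inverse on polynomials of bounded total degree. -/
theorem exists_antidifference₂ {p : ℕ} [Fact p.Prime] {N : ℕ} (hN : N + 1 < p)
    {R : (ZMod p)[X][X]} (hR : TotalDegreeLE N R) :
    ∃ R' : (ZMod p)[X][X], TotalDegreeLE (N + 1) R' ∧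
      ∀ b c : ZMod p, subst₂ b (c + 1) R' - subst₂ b c R' = subst₂ b c R := by
  let Q : Submodule (ZMod p) (ZMod p)[X][X] :=
    { carrier := {R | ∃ R' : (ZMod p)[X][X], TotalDegreeLE (N + 1) R' ∧
        ∀ b c : ZMod p, subst₂ b (c + 1) R' - subst₂ b c R' = subst₂ b c R}
      zero_mem' := ⟨0, totalDegreeLE_zero _, fun b c => by simp⟩
      add_mem' := by
        rintro R₁ R₂ ⟨R₁', h₁, e₁⟩ ⟨R₂', h₂, e₂⟩
        refine ⟨R₁' + R₂', h₁.add h₂, fun b c => ?_⟩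
        rw [map_add, map_add, map_add, ← e₁, ← e₂]
        ring
      smul_mem' := by
        rintro a R ⟨R', h, e⟩
        refine ⟨a • R', h.smul a, fun b c => ?_⟩
        rw [map_smul, map_smul, map_smul, ← e, smul_sub] }
  refine mem_of_monomials₂ Q R fun i j hij => ?_
  have := hR i j hij
  obtain ⟨S, hS, hSc⟩ := exists_antidifference (p := p) (j := j) (by omega)
  refine ⟨C X ^ i * S.map C, totalDegreeLE_C_mul (by omega) hS, fun b c => ?_⟩
  have h (b c : ZMod p) : subst₂ b c (S.map C) = S.eval c := by
    have := DFunLike.congr_fun (Polynomial.algHom_ext (R := ZMod p)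
      (f := (subst₂ b c).comp (mapAlgHom CAlgHom)) (g := aeval c) (by simp)) S
    rw [← coe_aeval_eq_eval]
    exact this
  simp only [map_mul, map_pow, subst₂_C, subst₂_X, aeval_X, h]
  rw [← mul_sub, hSc]

/-- A function of two variables of bounded degrees is a polynomial. -/
theorem exists_poly_of_bidegree [Fintype F] {k n : ℕ} (hk : k < Fintype.card F) {H : F → F → F}
    (hx : ∀ b, (fun a => H a b) ∈ reedSolomon F k) (hy : ∀ a, H a ∈ reedSolomon F n) :
    ∃ h : F[X][X][X], h.natDegree ≤ k ∧ (∀ m, TotalDegreeLE n (h.coeff m)) ∧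
      ∀ a b c, eval₃ h a b c = H a b := by
  classical
  obtain ⟨s, -, hs⟩ := Finset.exists_subset_card_eq (s := (Finset.univ : Finset F)) (n := k + 1)
    (by rw [Finset.card_univ]; omega)
  choose q hq hqH using hy
  -- Lagrange interpolation in x at k + 1 nodes, with the polynomials of y ↦ H i y as values.
  refine ⟨∑ i ∈ s, (Lagrange.basis s id i).map (C.comp C) * C (C (q i)), ?_, fun m => ?_, ?_⟩
  · refine natDegree_sum_le_of_forall_le _ _ fun i hi => ?_
    refine (natDegree_mul_C_le _ _).trans (natDegree_map_le.trans ?_)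
    rw [Lagrange.natDegree_basis Function.injective_id.injOn hi, hs, Nat.add_sub_cancel]
  · rw [finsetSum_coeff]
    refine Finset.sum_induction _ (TotalDegreeLE n) (fun _ _ => TotalDegreeLE.add)
      (totalDegreeLE_zero n) fun i _ => ?_
    rw [coeff_mul_C, coeff_map]
    intro i' j hij
    rw [RingHom.comp_apply, ← C_mul, coeff_C] at hij
    split_ifs at hij with hj
    · rw [coeff_C_mul] at hij
      have := (le_natDegree_of_ne_zero (right_ne_zero_of_mul hij)).trans (hq i)
      omega
    · simp at hij
  · intro a b c
    obtain ⟨P, hP, hPH⟩ := hx b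
    have h (i : F) : eval₃ ((Lagrange.basis s id i).map (C.comp C) * C (C (q i))) a b c =
        (Lagrange.basis s id i).eval a * P.eval i := by
      have hcomp : (subst₂ (F := F) b c : F[X][X] →+* F).comp (C.comp C) = RingHom.id F :=
        RingHom.ext fun a => by simp
      rw [eval₃_mul, ← eval_lineX, lineX_eq_map, Polynomial.map_map, hcomp, Polynomial.map_id,
        ← hPH, show (fun a => H a b) i = _ from hqH i b]
      simp [eval₃, aeval_def]
    have hdeg : P.degree < s.card := by
      rw [hs]
      exact (degree_le_of_natDegree_le hP).trans_lt (by exact_mod_cast Nat.lt_succ_self k)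
    have h' := congrArg (eval a)
      (Lagrange.eq_interpolate (v := id) Function.injective_id.injOn hdeg)
    rw [Lagrange.interpolate_apply, eval_finsetSum] at h'
    have hsum : eval₃ (∑ i ∈ s, (Lagrange.basis s id i).map (C.comp C) * C (C (q i))) a b c =
        ∑ i ∈ s, eval₃ ((Lagrange.basis s id i).map (C.comp C) * C (C (q i))) a b c := by
      simp only [eval₃, map_sum]
    rw [hsum, show H a b = _ from hPH a, h']
    refine Finset.sum_congr rfl fun i _ => ?_
    rw [h, eval_mul, eval_C, id, mul_comm]

/-- The forward difference in `z`. -/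
def diffZ (f : F × F × F → F) : F × F × F → F :=
  fun q => f (q.1, q.2.1, q.2.2 + 1) - f q

theorem diffZ_mem_skewCode {k l : ℕ} {f : F × F × F → F} (hf : f ∈ skewCode F k l) :
    diffZ f ∈ skewCode F k l := by
  refine ⟨fun b c => reedSolomon_sub (hf.1 b (c + 1)) (hf.1 b c), fun a c => ?_⟩
  have := reedSolomon_sub (hf.2 a (c + 1)) (hf.2 a c)
  simpa only [diffZ, add_assoc] using this

/-- The difference is σ − 1 for the shift σ, and in characteristic p one has (σ − 1)^p = σ^p − 1 =
0. -/
theorem diffZ_iterate_card (p : ℕ) [Fact p.Prime] (f : ZMod p × ZMod p × ZMod p → ZMod p) :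
    diffZ^[p] f = 0 := by
  let σ : Module.End (ZMod p) (ZMod p × ZMod p × ZMod p → ZMod p) :=
    LinearMap.funLeft _ _ fun q => (q.1, q.2.1, q.2.2 + 1)
  have hσ (n : ℕ) (f) : (σ ^ n) f = fun q => f (q.1, q.2.1, q.2.2 + n) := by
    induction n with
    | zero => simp
    | succ n ih =>
      rw [pow_succ', Module.End.mul_apply, ih]
      ext q
      simp [σ, LinearMap.funLeft_apply, add_assoc, add_comm (1 : ZMod p)]
  have hdiff (n : ℕ) (f) : diffZ^[n] f = ((σ - 1) ^ n) f := by
    rw [Module.End.pow_apply]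
    rfl
  have : CharP (Module.End (ZMod p) (ZMod p × ZMod p × ZMod p → ZMod p)) p :=
    charP_of_injective_algebraMap
      (FaithfulSMul.algebraMap_injective (ZMod p) _) p
  rw [hdiff, sub_pow_char_of_commute _ (Commute.one_right σ), one_pow, LinearMap.sub_apply, hσ]
  ext q
  simp

/-- A polynomial representing a word of the code has the degrees prescribed by the code, if its
degree is small. -/
theorem natDegree_flip₃_le_of_mem_skewCode [Fintype F] {k l N : ℕ} (hl : l ≤ N)
    (hN : k + N < Fintype.card F) {g : F[X][X][X]} (hk : g.natDegree ≤ k)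
    (hgN : ∀ m, TotalDegreeLE N (g.coeff m))
    (hg : (fun q : F × F × F => eval₃ g q.1 q.2.1 q.2.2) ∈ skewCode F k l) :
    (flip₃ g).natDegree ≤ l := by
  classical
  have hdeg := natDegree_flip₃_le hgN
  rw [natDegree_le_iff_coeff_eq_zero]
  intro m hm
  by_contra hne
  -- A coefficient of x^m with m > l vanishes at all |F|^2 points, because a polynomial of degree
  -- less than |F| on a line is determined by its values. This exceeds the |F|(k + N) zeros allowed.
  have hcard := card_zeros_le hne (totalDegreeLE_coeff_flip₃ hk hgN m)
  rw [Finset.filter_true_of_mem, Finset.card_univ, Fintype.card_prod] at hcard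
  · have := Nat.le_of_mul_le_mul_left hcard Fintype.card_pos
    omega
  · rintro ⟨b, c⟩ -
    obtain ⟨P, hP, hPe⟩ := hg.2 b (-c)
    have : lineX (flip₃ g) b c = P := by
      refine eq_of_eval_eq (n := N) (by omega) ((natDegree_lineX_le _ _ _).trans hdeg)
        (hP.trans hl) fun a => ?_
      rw [eval_lineX, eval₃_flip₃, ← hPe, mul_comm a b, sub_eq_add_neg]
    rw [← coeff_lineX, this]
    exact coeff_eq_zero_of_natDegree_lt (hP.trans_lt hm)

/-- The words of the code are polynomials, if the degrees are small. -/
theorem exists_poly_of_mem_skewCode {p : ℕ} [Fact p.Prime] {k l : ℕ} (hkl : 2 * k + l + 1 < p)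
    {f : ZMod p × ZMod p × ZMod p → ZMod p} (hf : f ∈ skewCode (ZMod p) k l) :
    ∃ g : (ZMod p)[X][X][X], g.natDegree ≤ k ∧ (flip₃ g).natDegree ≤ l ∧
      ∀ a b c, eval₃ g a b c = f (a, b, c) := by
  suffices h : ∀ n, diffZ^[n] f = 0 → ∃ g : (ZMod p)[X][X][X], g.natDegree ≤ k ∧
      (flip₃ g).natDegree ≤ l ∧ ∀ a b c, eval₃ g a b c = f (a, b, c) from
    h p (diffZ_iterate_card p f)
  -- Induction on the number of z-differences that annihilate f: the difference of f is a
  -- polynomial, and its antidifference G carries the dependence of f on z.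
  intro n
  induction n generalizing f with
  | zero =>
    intro h
    rw [Function.iterate_zero, id] at h
    exact ⟨0, by simp, by simp, fun a b c => by simp [h, eval₃]⟩
  | succ n ih =>
    intro h
    obtain ⟨g, hgk, hgl, hgf⟩ := ih (diffZ_mem_skewCode hf) h
    choose R' hR' hdiff using fun m =>
      exists_antidifference₂ (by omega) (totalDegreeLE_coeff hgk hgl m)
    let G : (ZMod p)[X][X][X] := ∑ m ∈ Finset.range (k + 1), C (R' m) * X ^ m
    have hGk : G.natDegree ≤ k := by
      refine natDegree_sum_le_of_forall_le _ _ fun m hm => (natDegree_C_mul_X_pow_le _ _).trans ?_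
      have := Finset.mem_range.mp hm
      omega
    have hGcoeff (m : ℕ) : TotalDegreeLE (k + l + 1) (G.coeff m) := by
      rw [finsetSum_coeff]
      refine Finset.sum_induction _ (TotalDegreeLE (k + l + 1)) (fun _ _ => TotalDegreeLE.add)
        (totalDegreeLE_zero _) fun i _ => ?_
      rw [coeff_C_mul_X_pow]
      split_ifs
      · exact hR' i
      · exact totalDegreeLE_zero _
    have hGdiff (a b c : ZMod p) : eval₃ G a b (c + 1) - eval₃ G a b c = eval₃ g a b c := by
      have hg := g.as_sum_range_C_mul_X_pow' (Nat.lt_succ_of_le hgk)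
      rw [hg]
      simp only [eval₃, G, map_sum, map_mul, map_pow, subst₃_C, subst₃_X]
      rw [← Finset.sum_sub_distrib]
      refine Finset.sum_congr rfl fun m _ => ?_
      rw [← sub_mul, hdiff]
    -- f − G is invariant under z ↦ z + 1, hence independent of z. Its degree in y can therefore be
    -- read off along (a, y, ay), where f has degree at most l and G at most k + l + 1.
    let H : ZMod p → ZMod p → ZMod p := fun a b => f (a, b, 0) - eval₃ G a b 0
    have hH (a b c : ZMod p) : f (a, b, c) = eval₃ G a b c + H a b := by
      obtain ⟨n, rfl⟩ := ZMod.natCast_zmod_surjective c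
      induction n with
      | zero => simp [H]
      | succ n ih =>
        have h1 := hGdiff a b n
        rw [hgf, diffZ] at h1
        push_cast
        linear_combination ih - h1
    obtain ⟨h, hhk, hhcoeff, hhH⟩ := exists_poly_of_bidegree (k := k) (n := k + l + 1) (H := H)
      (by rw [ZMod.card]; omega)
      (fun b => reedSolomon_sub (hf.1 b 0) (eval₃_mem_reedSolomon hGk b 0)) fun a => by
        have h1 := reedSolomon_sub (reedSolomon_mono (by omega) (hf.2 a 0))
          (eval₃_mem_reedSolomon (natDegree_flip₃_le hGcoeff) a 0)
        convert h1 using 2 with b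
        rw [hH, eval₃_flip₃, sub_zero, add_zero, mul_comm b a]
        ring
    have hval (a b c : ZMod p) : eval₃ (G + h) a b c = f (a, b, c) := by
      rw [eval₃_add, hhH, hH]
    have hk := natDegree_add_le_of_degree_le hGk hhk
    refine ⟨G + h, hk, ?_, hval⟩
    -- The antidifference loses control of the degree in the y-direction; membership in the code
    -- brings it back from k + l + 1 to l. This requires 2k + l + 1 < p.
    refine natDegree_flip₃_le_of_mem_skewCode (N := k + l + 1) (by omega)
      (by rw [ZMod.card]; omega) hk (fun m => ?_) ?_
    · rw [coeff_add]
      exact (hGcoeff m).add (hhcoeff m)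
    · simpa only [hval] using hf

end Representation

/-! ### Polynomials vanishing on a small set -/

section Interpolation

variable {F : Type*} [Field F]

/-- Monomials in `x`, `y`, `z` and `w = z - x y` of degree at most `A` in `x, w` and in `y, z`. -/
noncomputable def skewMonomial (u v t : ℕ) : F[X][X][X] :=
  if v ≤ u then X ^ (u - v) * (C X - X * C (C X)) ^ v * C X ^ t
  else C (C X) ^ (v - u) * (C X - X * C (C X)) ^ t * C X ^ u

theorem natDegree_skewMonomial_le {A u v t : ℕ} (hu : u ≤ A) (ht : t ≤ A) :
    (skewMonomial u v t : F[X][X][X]).natDegree ≤ A := by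
  have h (n : ℕ) : ((C X - X * C (C X)) ^ n : F[X][X][X]).natDegree ≤ n := by
    simpa using natDegree_pow_le_of_le n
      (show (C X - X * C (C X) : F[X][X][X]).natDegree ≤ 1 by compute_degree)
  rw [skewMonomial]
  split_ifs with huv
  · rw [← C_pow]
    refine (natDegree_mul_C_le _ _).trans (natDegree_mul_le.trans ?_)
    rw [natDegree_X_pow]
    have := h v
    omega
  · rw [← C_pow, ← C_pow, ← C_pow]
    exact (natDegree_mul_C_le _ _).trans ((natDegree_C_mul_le _ _).trans ((h t).trans ht))

theorem natDegree_flip₃_skewMonomial_le {A u v t : ℕ} (hv : v ≤ A) (ht : t ≤ A) :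
    (flip₃ (skewMonomial u v t : F[X][X][X])).natDegree ≤ A := by
  have h (n : ℕ) : ((X * C (C X) - C X) ^ n : F[X][X][X]).natDegree ≤ n := by
    exact (natDegree_pow_le_of_le n (show (X * C (C X) - C X : F[X][X][X]).natDegree ≤ 1 by
      compute_degree)).trans (by simp)
  -- w = z − xy is constant along the y-lines, just as z is along the x-lines.
  have hw : flip₃ (C X - X * C (C X) : F[X][X][X]) = C (-X) := by
    rw [map_sub (flip₃ (F := F)), map_mul, flip₃_C_X, flip₃_X, flip₃_C_C_X, C_neg]
    ring
  rw [skewMonomial]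
  split_ifs with huv
  · rw [map_mul, map_mul, map_pow, map_pow, map_pow, hw, flip₃_X, flip₃_C_X, ← C_pow, ← C_pow,
      ← C_pow, ← C_mul]
    exact (natDegree_C_mul_le _ _).trans ((h t).trans ht)
  · rw [map_mul, map_mul, map_pow, map_pow, map_pow, hw, flip₃_C_C_X, flip₃_C_X, ← C_pow]
    refine natDegree_mul_le.trans ?_
    have h1 := natDegree_mul_C_le (X ^ (v - u) : F[X][X][X]) ((-X) ^ t)
    rw [natDegree_X_pow] at h1
    have h2 := h u
    omega

/-- The substitution `x = T`, `y = (z - w) / T`, with independent variables `z`, `w`, `T`. -/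
noncomputable def laurentSubst : F[X][X][X] →ₐ[F] LaurentPolynomial F[X][X] :=
  subst₃ (S := LaurentPolynomial F[X][X]) (AddMonoidAlgebra.single 1 1)
    (AddMonoidAlgebra.single (-1) (C X - X)) (AddMonoidAlgebra.single 0 (C X))

/-- The exponent of `z` in `skewMonomial u v t`. -/
def zExponent (u v t : ℕ) : ℕ := if v ≤ u then t else u

/-- The exponent of `w` in `skewMonomial u v t`. -/
def wExponent (u v t : ℕ) : ℕ := if v ≤ u then v else t

theorem laurentSubst_skewMonomial (u v t : ℕ) :
    laurentSubst (skewMonomial u v t : F[X][X][X]) = AddMonoidAlgebra.single ((u : ℤ) - v)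
      ((C X - X) ^ (v - u) * (C X ^ zExponent u v t * X ^ wExponent u v t)) := by
  have hx : laurentSubst (X : F[X][X][X]) = AddMonoidAlgebra.single 1 1 := by simp [laurentSubst]
  have hy : laurentSubst (C (C X) : F[X][X][X]) = AddMonoidAlgebra.single (-1) (C X - X) := by
    simp [laurentSubst, -LaurentPolynomial.single_eq_C_mul_T]
  have hz : laurentSubst (C X : F[X][X][X]) = AddMonoidAlgebra.single 0 (C X) := by
    simp [laurentSubst]
  have hw : laurentSubst (C X - X * C (C X) : F[X][X][X]) = AddMonoidAlgebra.single 0 X := by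
    rw [map_sub (laurentSubst (F := F)), map_mul, hx, hy, hz, AddMonoidAlgebra.single_mul_single,
      add_neg_cancel, ← AddMonoidAlgebra.single_sub, one_mul, sub_sub_cancel]
  rw [skewMonomial, zExponent, wExponent]
  split_ifs with huv
  · rw [map_mul, map_mul, map_pow, map_pow, map_pow, hx, hw, hz]
    simp only [AddMonoidAlgebra.single_pow, AddMonoidAlgebra.single_mul_single]
    rw [Nat.sub_eq_zero_of_le huv]
    congr 1
    · simp; omega
    · simp; ring
  · rw [map_mul, map_mul, map_pow, map_pow, map_pow, hy, hw, hz]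
    simp only [AddMonoidAlgebra.single_pow, AddMonoidAlgebra.single_mul_single]
    congr 1
    · simp; omega
    · ring

theorem coeff_coeff_C_X_pow_mul_X_pow (a b m n : ℕ) :
    ((C X ^ a * X ^ b : F[X][X]).coeff n).coeff m = if n = b ∧ m = a then 1 else 0 := by
  rw [← C_pow, coeff_C_mul, coeff_X_pow]
  split_ifs <;> simp_all [coeff_X_pow]

/-- After the Laurent substitution the exponent of T is u − v. Terms with the same u − v share one
power of z − w; once it is cancelled, distinct monomials in z and w remain. -/
theorem skewMonomial_independent {A : ℕ} {g : Fin (A + 1) × Fin (A + 1) × Fin (A + 1) → F}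
    (hg : ∑ i, g i • (skewMonomial i.1 i.2.1 i.2.2 : F[X][X][X]) = 0) : g = 0 := by
  ext ⟨u, v, t⟩
  have h1 := congrArg laurentSubst hg
  simp only [map_sum, map_smul, map_zero, laurentSubst_skewMonomial] at h1
  have h2 := congrArg (fun r => AddMonoidAlgebra.coeff r ((u : ℤ) - v)) h1
  simp only [AddMonoidAlgebra.coeff_sum, AddMonoidAlgebra.coeff_smul, AddMonoidAlgebra.coeff_single,
    AddMonoidAlgebra.coeff_zero, Finsupp.coe_zero, Pi.zero_apply, Finsupp.finsetSum_apply,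
    Finsupp.smul_apply, Finsupp.single_apply] at h2
  have h3 : (C X - X) ^ (v - u : ℕ) * ∑ i : Fin (A + 1) × Fin (A + 1) × Fin (A + 1),
      g i • (if (i.1 : ℤ) - i.2.1 = u - v then (C X ^ zExponent i.1 i.2.1 i.2.2 *
        X ^ wExponent i.1 i.2.1 i.2.2 : F[X][X]) else 0) = 0 := by
    refine Eq.trans ?_ h2
    rw [Finset.mul_sum]
    refine Finset.sum_congr rfl fun i _ => ?_
    rw [mul_smul_comm]
    split_ifs with h
    · rw [show (v - u : ℕ) = i.2.1 - i.1 by omega]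
    · rw [mul_zero]
  have hne : (C X - X : F[X][X]) ≠ 0 := fun h => by
    have := congrArg (fun r => coeff r 1) h
    simp at this
  have h4 := (mul_eq_zero.mp h3).resolve_left (pow_ne_zero _ hne)
  have h5 := congrArg (fun r => (coeff r (wExponent u v t)).coeff (zExponent u v t)) h4
  simp only [finsetSum_coeff, coeff_smul, coeff_zero] at h5
  rw [Finset.sum_eq_single (u, v, t)] at h5
  · simpa [coeff_coeff_C_X_pow_mul_X_pow] using h5
  · rintro ⟨u', v', t'⟩ - hi
    split_ifs with h
    · rw [coeff_coeff_C_X_pow_mul_X_pow, if_neg, smul_zero]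
      rintro ⟨hw, hz⟩
      apply hi
      simp only [wExponent, zExponent] at hw hz h
      simp only [Prod.mk.injEq, Fin.ext_iff]
      split_ifs at hw hz <;> omega
    · simp
  · simp

/-- There is a nonzero polynomial of degree at most `A` in both directions that vanishes at fewer
than `(A + 1) ^ 3` given points. -/
theorem exists_vanishing (A : ℕ) (s : Finset (F × F × F)) (hs : s.card < (A + 1) ^ 3) :
    ∃ f : F[X][X][X], f ≠ 0 ∧ f.natDegree ≤ A ∧ (flip₃ f).natDegree ≤ A ∧
      ∀ q ∈ s, eval₃ f q.1 q.2.1 q.2.2 = 0 := by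
  let I := Fin (A + 1) × Fin (A + 1) × Fin (A + 1)
  let Φ : (I → F) →ₗ[F] F[X][X][X] :=
    Fintype.linearCombination F fun i : I => (skewMonomial i.1 i.2.1 i.2.2 : F[X][X][X])
  let ev : F[X][X][X] →ₗ[F] (s → F) :=
    LinearMap.pi fun q => (subst₃ q.1.1 q.1.2.1 q.1.2.2 : F[X][X][X] →ₐ[F] F).toLinearMap
  have hker : LinearMap.ker (ev ∘ₗ Φ) ≠ ⊥ := by
    refine LinearMap.ker_ne_bot_of_finrank_lt ?_
    simp only [Module.finrank_fintype_fun_eq_card, Fintype.card_coe, I, Fintype.card_prod,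
      Fintype.card_fin]
    calc s.card < (A + 1) ^ 3 := hs
      _ = _ := by ring
  obtain ⟨g, hg, hg0⟩ := Submodule.exists_mem_ne_zero_of_ne_bot hker
  have hΦ : Φ g = ∑ i, g i • (skewMonomial i.1 i.2.1 i.2.2 : F[X][X][X]) :=
    Fintype.linearCombination_apply _ _ _
  refine ⟨Φ g, fun h => hg0 (skewMonomial_independent (hΦ ▸ h)), ?_, ?_, fun q hq => ?_⟩
  · rw [hΦ]
    refine natDegree_sum_le_of_forall_le _ _ fun i _ => (natDegree_smul_le _ _).trans ?_
    exact natDegree_skewMonomial_le (by omega) (by omega)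
  · rw [hΦ, map_sum]
    refine natDegree_sum_le_of_forall_le _ _ fun i _ => ?_
    rw [map_smul]
    exact (natDegree_smul_le _ _).trans (natDegree_flip₃_skewMonomial_le (by omega) (by omega))
  · exact congrFun (LinearMap.mem_ker.mp hg) ⟨q, hq⟩

end Interpolation

/-! ### Agreement testing for the code -/

section Testing

variable {F : Type*} [Field F]

/-- A polynomial that has degree zero in both directions is constant. -/
theorem isUnit_of_natDegree_eq_zero {f : F[X][X][X]} (hf : f ≠ 0) (hk : f.natDegree = 0)
    (hl : (flip₃ f).natDegree = 0) : IsUnit f := by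
  have h := totalDegreeLE_coeff hk.le hl.le 0
  obtain ⟨R, rfl⟩ := natDegree_eq_zero.mp hk
  rw [coeff_C_zero] at h
  have hR : R = C (C ((R.coeff 0).coeff 0)) := by
    ext j i
    by_cases hij : i = 0 ∧ j = 0
    · obtain ⟨rfl, rfl⟩ := hij
      simp
    · have h1 : (R.coeff j).coeff i = 0 := by
        by_contra hne
        have := h i j hne
        omega
      rw [h1, coeff_C]
      split_ifs with hj
      · rw [coeff_C, if_neg (by omega)]
      · simp
  rw [hR] at hf ⊢
  rw [isUnit_C, isUnit_C, isUnit_C, isUnit_iff_ne_zero]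
  rintro h0
  simp [h0] at hf

theorem natDegree_mul_le_right {R : Type*} [CommRing R] [IsDomain R] {g f h : R[X]} {d : ℕ}
    (hg : g ≠ 0) (hf : f ≠ 0) (hd : (g * h).natDegree ≤ (g * f).natDegree + d) :
    h.natDegree ≤ f.natDegree + d := by
  by_cases hh : h = 0
  · simp [hh]
  · rw [natDegree_mul hg hh, natDegree_mul hg hf] at hd
    omega

variable [Fintype F]

/-- If `g f` divides `g h` on all lines in the direction of `x`, and `f` and `h` are relatively
prime, then the degrees cannot be small. -/
theorem card_le_of_dvd_lineX {f g h : F[X][X][X]} (hf : f ≠ 0) (hg : g ≠ 0)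
    (hfh : IsRelPrime f h) {dx dy : ℕ} (hdeg : (flip₃ f).natDegree ≤ f.natDegree)
    (hpos : 0 < f.natDegree) (hhx : h.natDegree ≤ f.natDegree + dx)
    (hhy : (flip₃ h).natDegree ≤ (flip₃ f).natDegree + dy)
    (hline : ∀ b c, ∃ r : F[X], r.natDegree ≤ dx ∧ lineX (g * h) b c = lineX (g * f) b c * r) :
    Fintype.card F ≤ g.natDegree + (flip₃ g).natDegree +
      (f.natDegree + 2 * (flip₃ f).natDegree + 2 * dx + dy) := by
  classical
  -- Each of the |F|^2 lines either lies in the zero set of g, or allows cancelling g so that f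
  -- divides h on it.
  have h1 := card_lineX_eq_zero_le hg le_rfl le_rfl
  have h2 := card_dvd_lineX_le hf hfh rfl le_rfl hdeg hpos hhx hhy
    (Finset.univ.filter fun q : F × F => ¬ lineX g q.1 q.2 = 0) fun q hq => by
      obtain ⟨r, hr, hrl⟩ := hline q.1 q.2
      refine ⟨r, hr, ?_⟩
      rw [lineX_mul, lineX_mul, mul_assoc] at hrl
      exact mul_left_cancel₀ (Finset.mem_filter.mp hq).2 hrl
  have h3 := Finset.card_filter_add_card_filter_not (s := (Finset.univ : Finset (F × F)))
    (fun q => lineX g q.1 q.2 = 0)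
  rw [Finset.card_univ, Fintype.card_prod] at h3
  refine Nat.le_of_mul_le_mul_left ?_ (Fintype.card_pos (α := F))
  rw [mul_add]
  omega

/-- A polynomial that is divisible by `f` on all lines in both directions is divisible by `f`, if
the degrees are small. -/
theorem dvd_of_dvd_lines {f h : F[X][X][X]} (hf : f ≠ 0) {A dx dy : ℕ} (hk : f.natDegree ≤ A)
    (hl : (flip₃ f).natDegree ≤ A) (hA : 2 * (dx + dy) + 3 * A < Fintype.card F)
    (hhx : h.natDegree ≤ f.natDegree + dx) (hhy : (flip₃ h).natDegree ≤ (flip₃ f).natDegree + dy)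
    (hx : ∀ b c, ∃ r : F[X], r.natDegree ≤ dx ∧ lineX h b c = lineX f b c * r)
    (hy : ∀ b c, ∃ r : F[X], r.natDegree ≤ dy ∧
      lineX (flip₃ h) b c = lineX (flip₃ f) b c * r) : f ∣ h := by
  obtain ⟨f, h, g, hfh, rfl, rfl⟩ := UniqueFactorizationMonoid.exists_reduced_factors f hf h
  have hg0 := left_ne_zero_of_mul hf
  have hf0 := right_ne_zero_of_mul hf
  have hg1 := (map_ne_zero_iff _ flip₃_injective).mpr hg0
  have hf1 := (map_ne_zero_iff _ flip₃_injective).mpr hf0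
  rw [map_mul, map_mul] at hhy
  rw [map_mul] at hl
  simp only [map_mul] at hy
  have hhx' := natDegree_mul_le_right hg0 hf0 hhx
  have hhy' := natDegree_mul_le_right hg1 hf1 hhy
  rw [natDegree_mul hg0 hf0] at hk
  rw [natDegree_mul hg1 hf1] at hl
  refine mul_dvd_mul_left g (IsUnit.dvd ?_)
  by_contra hunit
  -- Work in the direction where f has the larger degree, which is positive as f is not a unit. The
  -- degrees in `card_le_of_dvd_lineX` then add up to at most 3A + 2(dx + dy) < |F|.
  rcases le_total (flip₃ f).natDegree f.natDegree with hle | hle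
  · have hpos : 0 < f.natDegree := Nat.pos_of_ne_zero fun h0 =>
      hunit (isUnit_of_natDegree_eq_zero hf0 h0 (by omega))
    have := card_le_of_dvd_lineX hf0 hg0 hfh hle hpos hhx' hhy' hx
    omega
  · have hpos : 0 < (flip₃ f).natDegree := Nat.pos_of_ne_zero fun h0 =>
      hunit (isUnit_of_natDegree_eq_zero hf0 (by omega) h0)
    have := card_le_of_dvd_lineX hf1 hg1 (isRelPrime_flip₃ hfh) (by simpa using hle) hpos hhy'
      (by simpa using hhx') hy
    simp only [flip₃_flip₃] at this
    omega

end Testing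

/-! ### The error-locator argument -/

section Core

variable {p : ℕ} [Fact p.Prime]

/-- Local views on the lines in both directions that agree at all but fewer than `(A + 1) ^ 3`
points agree with a word of the code on all but few lines. -/
theorem exists_mem_skewCode_of_agreement {dx dy A : ℕ} (hA : 2 * (dx + dy) + 5 * A < p)
    (Z W : ZMod p → ZMod p → (ZMod p)[X]) (hZ : ∀ b c, (Z b c).natDegree ≤ dx)
    (hW : ∀ a c, (W a c).natDegree ≤ dy)
    (hbad : (Finset.univ.filter fun q : ZMod p × ZMod p × ZMod p =>
      (Z q.2.1 q.2.2).eval q.1 ≠ (W q.1 (q.2.2 - q.1 * q.2.1)).eval q.2.1).card < (A + 1) ^ 3) :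
    ∃ f ∈ skewCode (ZMod p) dx dy,
      (Finset.univ.filter fun q : ZMod p × ZMod p =>
        ∃ x, f (x, q.1, q.2) ≠ (Z q.1 q.2).eval x).card ≤ p * (2 * A) ∧
      (Finset.univ.filter fun q : ZMod p × ZMod p =>
        ∃ y, f (q.1, y, q.1 * y + q.2) ≠ (W q.1 q.2).eval y).card ≤ p * (2 * A) := by
  classical
  -- For A = 0 there are no bad points and Z itself is a codeword. The general case needs A ≥ 1 to
  -- absorb the + 1 in the hypothesis of `exists_poly_of_mem_skewCode`.
  obtain rfl | hA0 := Nat.eq_zero_or_pos A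
  · have hagree : ∀ a b c, (Z b c).eval a = (W a (c - a * b)).eval b := by
      simpa using hbad
    refine ⟨fun q => (Z q.2.1 q.2.2).eval q.1, ⟨fun b c => ⟨Z b c, hZ b c, fun _ => rfl⟩,
      fun a c => ⟨W a c, hW a c, fun y => ?_⟩⟩, ?_, ?_⟩
    · simp [hagree]
    · simp
    · simp [hagree]
  · obtain ⟨E, hE0, hEx, hEy, hEv⟩ := exists_vanishing A _ hbad
    set k := E.natDegree with hk
    set l := (flip₃ E).natDegree with hl
    -- E vanishes wherever Z and W disagree, so the two products coincide at every point.
    have hEW (a y c : ZMod p) : eval₃ E a y (a * y + c) * (Z y (a * y + c)).eval a =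
        (lineX (flip₃ E) a (-c) * W a c).eval y := by
      have hflip : eval₃ (flip₃ E) y a (-c) = eval₃ E a y (a * y + c) := by
        rw [eval₃_flip₃, sub_neg_eq_add, mul_comm y a]
      rw [eval_mul, eval_lineX, hflip]
      by_cases hq : (Z y (a * y + c)).eval a = (W a c).eval y
      · rw [hq]
      · rw [hEv (a, y, a * y + c) (by simpa using hq), zero_mul, zero_mul]
    obtain ⟨P, hPx, hPy, hPv⟩ := exists_poly_of_mem_skewCode (p := p) (k := k + dx) (l := l + dy)
      (by omega) (f := fun q => eval₃ E q.1 q.2.1 q.2.2 * (Z q.2.1 q.2.2).eval q.1)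
      ⟨fun b c => ⟨lineX E b c * Z b c, natDegree_mul_le.trans
          (Nat.add_le_add (natDegree_lineX_le E b c) (hZ b c)), fun a => by
            rw [eval_mul, eval_lineX]⟩,
        fun a c => ⟨lineX (flip₃ E) a (-c) * W a c, natDegree_mul_le.trans
          (Nat.add_le_add (natDegree_lineX_le _ _ _) (hW a c)), fun y => hEW a y c⟩⟩
    have hcard : Fintype.card (ZMod p) = p := ZMod.card p
    have hlx (b c : ZMod p) : lineX P b c = lineX E b c * Z b c := by
      refine eq_of_eval_eq (n := k + dx) (by omega) ((natDegree_lineX_le _ _ _).trans hPx)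
        (natDegree_mul_le.trans (Nat.add_le_add (natDegree_lineX_le E b c) (hZ b c))) fun a => ?_
      rw [eval_lineX, hPv, eval_mul, eval_lineX]
    have hly (a c : ZMod p) : lineX (flip₃ P) a (-c) = lineX (flip₃ E) a (-c) * W a c := by
      refine eq_of_eval_eq (n := l + dy) (by omega) ((natDegree_lineX_le _ _ _).trans hPy)
        (natDegree_mul_le.trans (Nat.add_le_add (natDegree_lineX_le _ _ _) (hW a c))) fun y => ?_
      rw [← hEW, eval_lineX, eval₃_flip₃, hPv, sub_neg_eq_add, mul_comm y a]
    obtain ⟨Q, rfl⟩ : E ∣ P := dvd_of_dvd_lines hE0 hEx hEy (by omega) hPx hPy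
      (fun b c => ⟨Z b c, hZ b c, hlx b c⟩) fun b c => ⟨W b (-c), hW b (-c), by
        simpa using hly b (-c)⟩
    have hE1 := (map_ne_zero_iff _ flip₃_injective).mpr hE0
    have hQx : Q.natDegree ≤ dx := by
      have := natDegree_mul_le_right hE0 one_ne_zero (d := dx) (h := Q) (by rwa [mul_one])
      simpa using this
    have hQy : (flip₃ Q).natDegree ≤ dy := by
      rw [map_mul] at hPy
      have := natDegree_mul_le_right hE1 one_ne_zero (d := dy) (h := flip₃ Q) (by rwa [mul_one])
      simpa using this
    refine ⟨_, eval₃_mem_skewCode hQx hQy, ?_, ?_⟩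
    · refine (Finset.card_le_card ?_).trans ((card_lineX_eq_zero_le hE0 hEx hEy).trans
        (by rw [hcard, two_mul]))
      intro q hq
      simp only [Finset.mem_filter, Finset.mem_univ, true_and] at hq ⊢
      obtain ⟨x, hx⟩ := hq
      by_contra hne
      apply hx
      have := hlx q.1 q.2
      rw [lineX_mul] at this
      rw [← mul_left_cancel₀ hne this, eval_lineX]
    · have hcount := card_lineX_eq_zero_le hE1 hEy (by simpa using hEx)
      rw [hcard, ← two_mul] at hcount
      -- `flip₃` carries the y-line with parameters (a, c) to the x-line over (a, −c).
      refine (Finset.card_le_card_of_injOn (fun q => (q.1, -q.2)) ?_ ?_).trans hcount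
      · rintro ⟨a, c⟩ hq
        simp only [Finset.coe_filter, Finset.mem_univ, true_and, Set.mem_ofPred_eq] at hq ⊢
        obtain ⟨y, hy⟩ := hq
        by_contra hne
        apply hy
        have := hly a c
        rw [map_mul, lineX_mul] at this
        rw [← mul_left_cancel₀ hne this, eval_lineX, eval₃_flip₃, sub_neg_eq_add, mul_comm y a]
      · rintro ⟨a, c⟩ - ⟨a', c'⟩ - h
        simpa using h

end Core

/-! ### Faces of a coset complex -/

section CosetComplex

variable {G ι : Type*} [Group G] {K : ι → Subgroup G}

theorem mem_cosetFace {g : G} {I : Finset ι} {w : Σ i, G ⧸ K i} :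
    w ∈ cosetFace K g I ↔ w.1 ∈ I ∧ (QuotientGroup.mk g : G ⧸ K w.1) = w.2 := by
  classical
  rw [cosetFace, Finset.mem_image]
  constructor
  · rintro ⟨i, hi, rfl⟩
    exact ⟨hi, rfl⟩
  · rintro ⟨hi, h⟩
    exact ⟨w.1, hi, by rw [h]⟩

theorem exists_eq_cosetFace {s : Finset (Σ i, G ⧸ K i)} (hs : s ∈ cosetComplex K) :
    ∃ (g : G) (I : Finset ι), I.card = s.card ∧ s = cosetFace K g I := by
  classical
  obtain ⟨-, g, hg⟩ := hs
  refine ⟨g, s.image Sigma.fst, Finset.card_image_of_injOn ?_, ?_⟩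
  · rintro ⟨i, a⟩ ha ⟨j, b⟩ hb hij
    have h1 := hg _ ha
    have h2 := hg _ hb
    obtain rfl : i = j := hij
    simp only at h1 h2
    rw [← h1, ← h2]
  · ext w
    rw [mem_cosetFace, Finset.mem_image]
    constructor
    · exact fun hw => ⟨⟨w, hw, rfl⟩, hg w hw⟩
    · rintro ⟨⟨w', hw', h⟩, hw⟩
      obtain ⟨j, b⟩ := w'
      obtain ⟨i, a⟩ := w
      obtain rfl : j = i := h
      have h1 := hg _ hw'
      simp only at h1 hw
      rw [← hw, h1]
      exact hw'

theorem exists_eq_cosetFace_univ [Fintype ι] {s : Finset (Σ i, G ⧸ K i)} (hs : s ∈ cosetComplex K)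
    (hcard : s.card = Fintype.card ι) : ∃ g : G, s = cosetFace K g Finset.univ := by
  obtain ⟨g, I, hI, rfl⟩ := exists_eq_cosetFace hs
  rw [hcard, Finset.card_eq_iff_eq_univ] at hI
  exact ⟨g, by rw [hI]⟩

end CosetComplex

/-! ### The groups `K_i` -/

section Groups

variable {F : Type*} [Field F] (φ : F[X])

/-- The element of `K_i` with coordinates `x`, `y`, `z`, chosen in such a way that right
multiplication by `h_{i+1}` and `h_{i-1}` moves it along the lines of the code. -/
noncomputable def heis (i : Fin 3) (q : F × F × F) : bigGroup φ :=
  -- In `kElt_mul` the third group has the cocycle b a' instead of a b', so a and b exchange roles.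
  ⟨if i = 2 then kElt φ i q.2.1 q.1 q.2.2 else kElt φ i q.1 q.2.1 q.2.2, by
    refine le_iSup (kGroup φ) i ?_
    split_ifs
    · exact ⟨_, _, _, rfl⟩
    · exact ⟨_, _, _, rfl⟩⟩

theorem hMat_succ (i : Fin 3) (α : F) :
    hMat φ (i + 1) α = if i = 2 then kElt φ i 0 α 0 else kElt φ i α 0 0 := by
  fin_cases i <;> ext j k <;> fin_cases j <;> fin_cases k <;> simp [kElt, hMat]

theorem hMat_pred (i : Fin 3) (α : F) :
    hMat φ (i - 1) α = if i = 2 then kElt φ i α 0 0 else kElt φ i 0 α 0 := by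
  have h : (-1 : Fin 3) = 2 := rfl
  fin_cases i <;> ext j k <;> fin_cases j <;> fin_cases k <;> simp [kElt, hMat, h]

theorem heis_mul_hElt_succ (i : Fin 3) (x y z α : F) :
    heis φ i (x, y, z) * hElt φ (i + 1) α = heis φ i (x + α, y, z) := by
  refine Subtype.ext ?_
  simp only [heis, hElt, Subgroup.coe_mul, hMat_succ]
  split_ifs with hi
  · rw [kElt_mul, if_pos hi]
    congr 1 <;> ring
  · rw [kElt_mul, if_neg hi]
    congr 1 <;> ring

theorem heis_mul_hElt_pred (i : Fin 3) (x y z α : F) :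
    heis φ i (x, y, z) * hElt φ (i - 1) α = heis φ i (x, y + α, z + x * α) := by
  refine Subtype.ext ?_
  simp only [heis, hElt, Subgroup.coe_mul, hMat_pred]
  split_ifs with hi
  · rw [kElt_mul, if_pos hi]
    congr 1 <;> ring
  · rw [kElt_mul, if_neg hi]
    congr 1 <;> ring

theorem mem_kSub_iff {i : Fin 3} {g : bigGroup φ} : g ∈ kSub φ i ↔ ∃ q, g = heis φ i q := by
  rw [kSub, Subgroup.mem_subgroupOf]
  constructor
  · rintro ⟨a, b, c, h⟩
    by_cases hi : i = 2
    · exact ⟨(b, a, c), Subtype.ext (by simp [heis, hi, h])⟩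
    · exact ⟨(a, b, c), Subtype.ext (by simp [heis, hi, h])⟩
  · rintro ⟨q, rfl⟩
    simp only [heis]
    split_ifs
    · exact ⟨_, _, _, rfl⟩
    · exact ⟨_, _, _, rfl⟩

variable {φ}

theorem kElt_inj (hφ : Irreducible φ) (ht : AdjoinRoot.root φ ≠ 0) {i : Fin 3}
    {a b c a' b' c' : F} (h : kElt φ i a b c = kElt φ i a' b' c') :
    a = a' ∧ b = b' ∧ c = c' := by
  have := Fact.mk hφ
  have hent (j k : Fin 3) := congrFun (congrFun (congrArg Subtype.val h) j) k
  have hinj := (AdjoinRoot.of φ).injective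
  fin_cases i
  · have h1 := hent 0 1
    have h2 := hent 1 2
    have h3 := hent 0 2
    simp [kElt, ht, hinj.eq_iff] at h1 h2 h3
    exact ⟨h1, h2, h3⟩
  · have h1 := hent 1 2
    have h2 := hent 2 0
    have h3 := hent 1 0
    simp [kElt, ht, hinj.eq_iff] at h1 h2 h3
    exact ⟨h1, h2, h3⟩
  · have h1 := hent 0 1
    have h2 := hent 2 0
    have h3 := hent 2 1
    simp [kElt, ht, hinj.eq_iff] at h1 h2 h3
    exact ⟨h1, h2, h3⟩

theorem heis_injective (hφ : Irreducible φ) (ht : AdjoinRoot.root φ ≠ 0) (i : Fin 3) :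
    Function.Injective (heis φ i) := by
  rintro ⟨x, y, z⟩ ⟨x', y', z'⟩ h
  have h := congrArg Subtype.val h
  simp only [heis] at h
  split_ifs at h
  · obtain ⟨rfl, rfl, rfl⟩ := kElt_inj hφ ht h
    rfl
  · obtain ⟨rfl, rfl, rfl⟩ := kElt_inj hφ ht h
    rfl

/-- The zero patterns of the two other groups have only one free entry in common. -/
theorem eq_hElt_of_mem (hφ : Irreducible φ) (ht : AdjoinRoot.root φ ≠ 0) {i : Fin 3}
    {g : bigGroup φ} (hg : ∀ j ≠ i, g ∈ kSub φ j) : ∃ α, g = hElt φ i α := by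
  have := Fact.mk hφ
  suffices h : ∃ α, g.1 = hMat φ i α by
    obtain ⟨α, h⟩ := h
    exact ⟨α, Subtype.ext h⟩
  fin_cases i
  · obtain ⟨a, b, c, h1⟩ := hg 1 (by decide)
    obtain ⟨a', b', c', h2⟩ := hg 2 (by decide)
    have hent (j k : Fin 3) := congrFun (congrFun (congrArg Subtype.val (h1.symm.trans h2)) j) k
    have e1 := hent 1 2
    have e2 := hent 1 0
    simp [kElt, ht] at e1 e2
    refine ⟨b, h1.trans ?_⟩
    ext j k
    fin_cases j <;> fin_cases k <;> simp [kElt, hMat, e1, e2]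
  · obtain ⟨a, b, c, h1⟩ := hg 0 (by decide)
    obtain ⟨a', b', c', h2⟩ := hg 2 (by decide)
    have hent (j k : Fin 3) := congrFun (congrFun (congrArg Subtype.val (h1.symm.trans h2)) j) k
    have e1 := hent 1 2
    have e2 := hent 0 2
    simp [kElt, ht] at e1 e2
    refine ⟨a, h1.trans ?_⟩
    ext j k
    fin_cases j <;> fin_cases k <;> simp [kElt, hMat, e1, e2]
  · obtain ⟨a, b, c, h1⟩ := hg 0 (by decide)
    obtain ⟨a', b', c', h2⟩ := hg 1 (by decide)
    have hent (j k : Fin 3) := congrFun (congrFun (congrArg Subtype.val (h1.symm.trans h2)) j) k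
    have e1 := hent 0 1
    have e2 := hent 0 2
    simp [kElt, ht] at e1 e2
    refine ⟨b, h1.trans ?_⟩
    ext j k
    fin_cases j <;> fin_cases k <;> simp [kElt, hMat, e1, e2]

theorem heis_zero (i : Fin 3) : heis φ i (0, 0, 0) = 1 := by
  refine Subtype.ext ?_
  simp [heis, kElt_zero]

theorem hElt_succ_eq_heis (i : Fin 3) (α : F) : hElt φ (i + 1) α = heis φ i (α, 0, 0) := by
  rw [← one_mul (hElt _ _ _), ← heis_zero i, heis_mul_hElt_succ, zero_add]

theorem hElt_pred_eq_heis (i : Fin 3) (α : F) : hElt φ (i - 1) α = heis φ i (0, α, 0) := by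
  rw [← one_mul (hElt _ _ _), ← heis_zero i, heis_mul_hElt_pred, zero_add, zero_mul, zero_add]

/-- The quotient g⁻¹g' lies in all three groups, hence on both the x-axis and the y-axis of the
Heisenberg coordinates of `K_1`. -/
theorem triangleOf_injective (hφ : Irreducible φ) (ht : AdjoinRoot.root φ ≠ 0) :
    Function.Injective (triangleOf φ) := by
  intro g g' h
  have hmem (j : Fin 3) : g⁻¹ * g' ∈ kSub φ j := by
    have h1 : (⟨j, QuotientGroup.mk g'⟩ : Vertex φ) ∈ triangleOf φ g := by
      rw [h]
      exact mem_cosetFace.2 ⟨Finset.mem_univ _, rfl⟩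
    exact QuotientGroup.eq.1 (mem_cosetFace.1 h1).2
  obtain ⟨α, hα⟩ := eq_hElt_of_mem hφ ht (i := 0 + 1) fun j _ => hmem j
  obtain ⟨β, hβ⟩ := eq_hElt_of_mem hφ ht (i := 0 - 1) fun j _ => hmem j
  rw [hElt_succ_eq_heis] at hα
  rw [hElt_pred_eq_heis] at hβ
  have h0 := heis_injective hφ ht 0 (hα.symm.trans hβ)
  simp only [Prod.mk.injEq] at h0
  rw [h0.1, heis_zero] at hα
  exact (inv_mul_eq_one.1 hα)

/-- Besides irreducibility, this is all that is used of primitivity: zero has order 0, while the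
order of t is positive. -/
theorem IsPrimitivePoly.root_ne_zero [Finite F] (h : IsPrimitivePoly φ) :
    AdjoinRoot.root φ ≠ 0 := by
  have := Fact.mk h.1
  intro h0
  have h1 := h.2
  rw [h0, orderOf_zero] at h1
  have h2 : 1 < Nat.card F := Finite.one_lt_card
  have h3 : 1 < Nat.card F ^ φ.natDegree := Nat.one_lt_pow h.1.natDegree_pos.ne' h2
  omega

end Groups

/-! ### The star and the link of a vertex -/

section LocalStructure

variable {F : Type*} [Field F] {φ : F[X]}

theorem mem_triangleOf {g : bigGroup φ} {w : Vertex φ} :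
    w ∈ triangleOf φ g ↔ (QuotientGroup.mk g : bigGroup φ ⧸ kSub φ w.1) = w.2 := by
  rw [triangleOf, mem_cosetFace]
  simp

theorem mem_edgeOf {j : Fin 3} {g : bigGroup φ} {w : Vertex φ} :
    w ∈ edgeOf φ j g ↔ w.1 ≠ j ∧ (QuotientGroup.mk g : bigGroup φ ⧸ kSub φ w.1) = w.2 := by
  rw [edgeOf, mem_cosetFace]
  simp

theorem exists_eq_triangleOf {s : Finset (Vertex φ)} (hs : s ∈ triComplex φ) (hcard : s.card = 3) :
    ∃ g, s = triangleOf φ g :=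
  exists_eq_cosetFace_univ hs (by simpa using hcard)

theorem triangleOf_mem_triComplex (g : bigGroup φ) : triangleOf φ g ∈ triComplex φ :=
  (cosetFace_mem_star (kSub φ) g (Finset.subset_univ ∅) (k := 2) (by simp)).1

theorem card_triangleOf (g : bigGroup φ) : (triangleOf φ g).card = 3 :=
  (cosetFace_mem_star (kSub φ) g (Finset.subset_univ ∅) (k := 2) (by simp)).2.1

theorem edgeOf_mem_triComplex (j : Fin 3) (g : bigGroup φ) : edgeOf φ j g ∈ triComplex φ :=
  (cosetFace_mem_star (kSub φ) g (Finset.empty_subset {j}ᶜ) (k := 1)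
    (by simp [Finset.card_compl])).1

theorem card_edgeOf (j : Fin 3) (g : bigGroup φ) : (edgeOf φ j g).card = 2 :=
  (cosetFace_mem_star (kSub φ) g (Finset.empty_subset {j}ᶜ) (k := 1)
    (by simp [Finset.card_compl])).2.1

/-- The triangles containing the type-`j` edge of `g` are those of the elements `g h_j(α)`. -/
theorem exists_eq_triangleOf_mul_hElt (hφ : Irreducible φ) (ht : AdjoinRoot.root φ ≠ 0) {j : Fin 3}
    {g : bigGroup φ} {s : Finset (Vertex φ)} (hs : s ∈ Star (triComplex φ) (edgeOf φ j g) 2) :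
    ∃ α, s = triangleOf φ (g * hElt φ j α) := by
  obtain ⟨g', rfl⟩ := exists_eq_triangleOf hs.1 hs.2.1
  obtain ⟨α, hα⟩ := eq_hElt_of_mem hφ ht (i := j) (g := g⁻¹ * g') fun k hk => by
    have h : (⟨k, QuotientGroup.mk g⟩ : Vertex φ) ∈ triangleOf φ g' :=
      hs.2.2 (mem_edgeOf.2 ⟨hk, rfl⟩)
    exact QuotientGroup.eq.1 (mem_triangleOf.1 h).symm
  exact ⟨α, by rw [← hα, mul_inv_cancel_left]⟩

theorem mk_mul_heis (i : Fin 3) (g : bigGroup φ) (q : F × F × F) :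
    (QuotientGroup.mk (g * heis φ i q) : bigGroup φ ⧸ kSub φ i) = QuotientGroup.mk g :=
  QuotientGroup.mk_mul_of_mem g ((mem_kSub_iff φ).2 ⟨q, rfl⟩)

theorem exists_eq_mul_heis {i : Fin 3} {g g' : bigGroup φ}
    (h : (QuotientGroup.mk g' : bigGroup φ ⧸ kSub φ i) = QuotientGroup.mk g) :
    ∃ q, g' = g * heis φ i q := by
  obtain ⟨q, hq⟩ := (mem_kSub_iff φ).1 (QuotientGroup.eq.1 h.symm)
  exact ⟨q, by rw [← hq, mul_inv_cancel_left]⟩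

theorem triangleOf_mem_star_vertex (i : Fin 3) (g : bigGroup φ) (q : F × F × F) :
    triangleOf φ (g * heis φ i q) ∈
      Star (triComplex φ) {(⟨i, QuotientGroup.mk g⟩ : Vertex φ)} 2 :=
  ⟨triangleOf_mem_triComplex _, card_triangleOf _,
    Finset.singleton_subset_iff.2 (mem_triangleOf.2 (mk_mul_heis i g q))⟩

/-- The coordinates on the set of triangles containing a vertex. -/
noncomputable def starEquiv (hφ : Irreducible φ) (ht : AdjoinRoot.root φ ≠ 0) (i : Fin 3)
    (g : bigGroup φ) :
    F × F × F ≃ Star (triComplex φ) {(⟨i, QuotientGroup.mk g⟩ : Vertex φ)} 2 :=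
  Equiv.ofBijective
    (fun q => ⟨triangleOf φ (g * heis φ i q), triangleOf_mem_star_vertex i g q⟩) <| by
    constructor
    · intro q q' h
      exact heis_injective hφ ht i
        (mul_left_cancel (triangleOf_injective hφ ht (congrArg Subtype.val h)))
    · rintro ⟨s, hs⟩
      obtain ⟨g', rfl⟩ := exists_eq_triangleOf hs.1 hs.2.1
      obtain ⟨q, rfl⟩ :=
        exists_eq_mul_heis (mem_triangleOf.1 (Finset.singleton_subset_iff.1 hs.2.2))
      exact ⟨q, rfl⟩

theorem Fin.three_cases (i j : Fin 3) : j = i ∨ j = i + 1 ∨ j = i - 1 := by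
  revert i j
  decide

theorem Fin.three_add_one_ne (i : Fin 3) : i + 1 ≠ i := by
  revert i
  decide

theorem Fin.three_sub_one_ne (i : Fin 3) : i - 1 ≠ i := by
  revert i
  decide

theorem Fin.three_add_one_ne_sub_one (i : Fin 3) : i + 1 ≠ i - 1 := by
  revert i
  decide

/-- The edges at v of types i + 1 and i − 1 are the x-lines and y-lines. Another representative g
only moves the base point on the line, a translation that preserves Reed–Solomon codes. -/
theorem mem_vertexCode_iff (hφ : Irreducible φ) (ht : AdjoinRoot.root φ ≠ 0) (d : Fin 3 → ℕ)
    (i : Fin 3) (g : bigGroup φ)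
    (f : Star (triComplex φ) {(⟨i, QuotientGroup.mk g⟩ : Vertex φ)} 2 → F) :
    f ∈ vertexCode (triComplex φ) (edgeCode φ d) ⟨i, QuotientGroup.mk g⟩ ↔
      f ∘ starEquiv hφ ht i g ∈ skewCode F (d (i + 1)) (d (i - 1)) := by
  have hmem (j : Fin 3) (hj : i ≠ j) (q : F × F × F) : edgeOf φ j (g * heis φ i q) ∈
      Star (triComplex φ) {(⟨i, QuotientGroup.mk g⟩ : Vertex φ)} 1 :=
    ⟨edgeOf_mem_triComplex _ _, card_edgeOf _ _,
      Finset.singleton_subset_iff.2 (mem_edgeOf.2 ⟨hj, mk_mul_heis i g q⟩)⟩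
  have hf (q : F × F × F) {s : Finset (Vertex φ)} (hs) (h : s = triangleOf φ (g * heis φ i q)) :
      f ⟨s, hs⟩ = f (starEquiv hφ ht i g q) :=
    congrArg f (Subtype.ext h)
  constructor
  · intro h
    constructor
    · intro b c
      convert h _ (hmem (i + 1) (Fin.three_add_one_ne i).symm (0, b, c)) (i + 1) _ rfl
        using 2 with x
      refine (hf _ _ (congrArg (triangleOf φ) ?_)).symm
      rw [mul_assoc, heis_mul_hElt_succ, zero_add]
    · intro a c
      convert h _ (hmem (i - 1) (Fin.three_sub_one_ne i).symm (a, 0, c)) (i - 1) _ rfl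
        using 2 with y
      refine (hf _ _ (congrArg (triangleOf φ) ?_)).symm
      rw [mul_assoc, heis_mul_hElt_pred, zero_add, add_comm c]
  · rintro ⟨hx, hy⟩ e he j g' rfl
    have hv := mem_edgeOf.1 (Finset.singleton_subset_iff.1 he.2.2)
    obtain ⟨⟨x, y, z⟩, rfl⟩ := exists_eq_mul_heis hv.2
    rcases Fin.three_cases i j with rfl | rfl | rfl
    · exact absurd rfl hv.1
    · convert reedSolomon_translate (hx y z) x using 2 with α
      refine hf _ _ (congrArg (triangleOf φ) ?_)
      rw [mul_assoc, heis_mul_hElt_succ]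
    · convert reedSolomon_translate (hy x (z - x * y)) y using 2 with α
      refine hf _ _ (congrArg (triangleOf φ) ?_)
      rw [mul_assoc, heis_mul_hElt_pred]
      congr 4
      ring

/-- The neighbours of the vertex `g K_i` of type `i - 1` (left) and of type `i + 1` (right). -/
noncomputable def neighbour (i : Fin 3) (g : bigGroup φ) : F × F ⊕ F × F → Vertex φ
  | Sum.inl q => ⟨i - 1, QuotientGroup.mk (g * heis φ i (0, q.1, q.2))⟩
  | Sum.inr q => ⟨i + 1, QuotientGroup.mk (g * heis φ i (q.1, 0, q.2))⟩

theorem vertex_union_neighbour_inl [DecidableEq (Vertex φ)] (i : Fin 3) (g : bigGroup φ) (b c : F) :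
    {(⟨i, QuotientGroup.mk g⟩ : Vertex φ)} ∪ {neighbour i g (Sum.inl (b, c))} =
      edgeOf φ (i + 1) (g * heis φ i (0, b, c)) := by
  ext ⟨j, w⟩
  rw [mem_edgeOf]
  simp only [Finset.mem_union, Finset.mem_singleton]
  constructor
  · rintro (h | h)
    · obtain ⟨rfl, h⟩ := Sigma.mk.inj_iff.1 h
      obtain rfl := eq_of_heq h
      exact ⟨(Fin.three_add_one_ne j).symm, mk_mul_heis j g _⟩
    · obtain ⟨rfl, h⟩ := Sigma.mk.inj_iff.1 h
      obtain rfl := eq_of_heq h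
      exact ⟨(Fin.three_add_one_ne_sub_one i).symm, rfl⟩
  · rintro ⟨hj, rfl⟩
    rcases Fin.three_cases i j with rfl | rfl | rfl
    · exact Or.inl (by rw [mk_mul_heis])
    · exact absurd rfl hj
    · exact Or.inr rfl

theorem vertex_union_neighbour_inr [DecidableEq (Vertex φ)] (i : Fin 3) (g : bigGroup φ) (a c : F) :
    {(⟨i, QuotientGroup.mk g⟩ : Vertex φ)} ∪ {neighbour i g (Sum.inr (a, c))} =
      edgeOf φ (i - 1) (g * heis φ i (a, 0, c)) := by
  ext ⟨j, w⟩
  rw [mem_edgeOf]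
  simp only [Finset.mem_union, Finset.mem_singleton]
  constructor
  · rintro (h | h)
    · obtain ⟨rfl, h⟩ := Sigma.mk.inj_iff.1 h
      obtain rfl := eq_of_heq h
      exact ⟨(Fin.three_sub_one_ne j).symm, mk_mul_heis j g _⟩
    · obtain ⟨rfl, h⟩ := Sigma.mk.inj_iff.1 h
      obtain rfl := eq_of_heq h
      exact ⟨Fin.three_add_one_ne_sub_one i, rfl⟩
  · rintro ⟨hj, rfl⟩
    rcases Fin.three_cases i j with rfl | rfl | rfl
    · exact Or.inl (by rw [mk_mul_heis])
    · exact Or.inr rfl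
    · exact absurd rfl hj

theorem vertex_union_edgeOf [DecidableEq (Vertex φ)] (i : Fin 3) (g : bigGroup φ) (q : F × F × F) :
    {(⟨i, QuotientGroup.mk g⟩ : Vertex φ)} ∪ edgeOf φ i (g * heis φ i q) =
      triangleOf φ (g * heis φ i q) := by
  ext ⟨j, w⟩
  rw [mem_triangleOf, Finset.mem_union, Finset.mem_singleton, mem_edgeOf]
  constructor
  · rintro (h | h)
    · obtain ⟨rfl, h⟩ := Sigma.mk.inj_iff.1 h
      obtain rfl := eq_of_heq h
      exact mk_mul_heis j g _
    · exact h.2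
  · intro h
    change (QuotientGroup.mk _ : bigGroup φ ⧸ kSub φ j) = w at h
    subst h
    by_cases hj : j = i
    · subst hj
      exact Or.inl (by rw [mk_mul_heis])
    · exact Or.inr ⟨hj, rfl⟩

theorem neighbour_fst_ne (i : Fin 3) (g : bigGroup φ) (m : F × F ⊕ F × F) :
    (neighbour i g m).1 ≠ i := by
  rcases m with m | m
  · exact Fin.three_sub_one_ne i
  · exact Fin.three_add_one_ne i

theorem neighbour_injective (hφ : Irreducible φ) (ht : AdjoinRoot.root φ ≠ 0) (i : Fin 3)
    (g : bigGroup φ) : Function.Injective (neighbour i g) := by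
  -- i + i − k is the index other than i and k. Elements sharing their cosets of both these types
  -- differ by some h_k(α); the normalization x = 0 or y = 0 then forces α = 0.
  have key (k : Fin 3) (hk : k ≠ i) (q q' : F × F × F)
      (h : (QuotientGroup.mk (g * heis φ i q) : bigGroup φ ⧸ kSub φ (i + i - k)) =
        QuotientGroup.mk (g * heis φ i q')) :
      ∃ α, heis φ i q' = heis φ i q * hElt φ k α := by
    obtain ⟨α, hα⟩ := eq_hElt_of_mem hφ ht (i := k) (g := (heis φ i q)⁻¹ * heis φ i q')
      fun j hj => by
        have hj' : j = i ∨ j = i + i - k := by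
          clear h
          revert i j k
          decide
        rcases hj' with rfl | rfl
        · exact mul_mem (inv_mem ((mem_kSub_iff φ).2 ⟨q, rfl⟩)) ((mem_kSub_iff φ).2 ⟨q', rfl⟩)
        · have := QuotientGroup.eq.1 h
          rwa [mul_inv_rev, mul_assoc, inv_mul_cancel_left] at this
    exact ⟨α, by rw [← hα, mul_inv_cancel_left]⟩
  have h1 : i + i - (i + 1) = i - 1 := by
    clear key
    revert i
    decide
  have h2 : i + i - (i - 1) = i + 1 := by
    clear key h1
    revert i
    decide
  rintro (⟨b, c⟩ | ⟨a, c⟩) (⟨b', c'⟩ | ⟨a', c'⟩) h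
  · obtain ⟨α, hα⟩ := key (i + 1) (Fin.three_add_one_ne i) (0, b, c) (0, b', c')
      (by rw [h1]; exact eq_of_heq (Sigma.mk.inj_iff.1 h).2)
    rw [heis_mul_hElt_succ] at hα
    have := heis_injective hφ ht i hα
    simp only [Prod.mk.injEq] at this
    rw [this.2.1, this.2.2]
  · exact absurd (congrArg Sigma.fst h) (Fin.three_add_one_ne_sub_one i).symm
  · exact absurd (congrArg Sigma.fst h) (Fin.three_add_one_ne_sub_one i)
  · obtain ⟨α, hα⟩ := key (i - 1) (Fin.three_sub_one_ne i) (a, 0, c) (a', 0, c')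
      (by rw [h2]; exact eq_of_heq (Sigma.mk.inj_iff.1 h).2)
    rw [heis_mul_hElt_pred] at hα
    have := heis_injective hφ ht i hα
    simp only [Prod.mk.injEq] at this
    obtain ⟨rfl, h0, h3⟩ := this
    rw [zero_add] at h0
    rw [h3, ← h0, mul_zero, add_zero]

theorem neighbour_mem_link (i : Fin 3) (g : bigGroup φ) (m : F × F ⊕ F × F) :
    {neighbour i g m} ∈ Link (triComplex φ) {(⟨i, QuotientGroup.mk g⟩ : Vertex φ)} 0 := by
  let _ : DecidableEq (Vertex φ) := fun a b => Classical.propDecidable (a = b)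
  refine ⟨Finset.card_singleton _, ?_, ?_⟩
  · rw [Finset.disjoint_singleton]
    intro h
    exact neighbour_fst_ne i g m (congrArg Sigma.fst h).symm
  · rcases m with ⟨b, c⟩ | ⟨a, c⟩
    · rw [vertex_union_neighbour_inl]
      exact edgeOf_mem_triComplex _ _
    · rw [vertex_union_neighbour_inr]
      exact edgeOf_mem_triComplex _ _

theorem exists_eq_neighbour {i : Fin 3} {g : bigGroup φ} {s : Finset (Vertex φ)}
    (hs : s ∈ Link (triComplex φ) {(⟨i, QuotientGroup.mk g⟩ : Vertex φ)} 0) :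
    ∃ m, {neighbour i g m} = s := by
  obtain ⟨h1, h2, -, g', h3⟩ := hs
  obtain ⟨⟨j, w⟩, rfl⟩ := Finset.card_eq_one.1 h1
  have hv := h3 ⟨i, QuotientGroup.mk g⟩ (by simp)
  have hw : (QuotientGroup.mk g' : bigGroup φ ⧸ kSub φ j) = w := h3 ⟨j, w⟩ (by simp)
  subst hw
  obtain ⟨⟨x, y, z⟩, rfl⟩ := exists_eq_mul_heis hv
  rcases Fin.three_cases i j with rfl | rfl | rfl
  · rw [mk_mul_heis] at h2
    simp at h2
  · refine ⟨Sum.inr (x, z - x * y), ?_⟩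
    have h : heis φ i (x, y, z) = heis φ i (x, 0, z - x * y) * hElt φ (i - 1) y := by
      rw [heis_mul_hElt_pred, zero_add, sub_add_cancel]
    rw [h, ← mul_assoc,
      QuotientGroup.mk_mul_of_mem _ (hElt_mem φ _ _ (Fin.three_add_one_ne_sub_one i) y)]
    rfl
  · refine ⟨Sum.inl (y, z), ?_⟩
    have h : heis φ i (x, y, z) = heis φ i (0, y, z) * hElt φ (i + 1) x := by
      rw [heis_mul_hElt_succ, zero_add]
    rw [h, ← mul_assoc,
      QuotientGroup.mk_mul_of_mem _ (hElt_mem φ _ _ (Fin.three_add_one_ne_sub_one i).symm x)]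
    rfl

/-- The coordinates on the set of vertices of the link of a vertex. -/
noncomputable def linkVertexEquiv (hφ : Irreducible φ) (ht : AdjoinRoot.root φ ≠ 0) (i : Fin 3)
    (g : bigGroup φ) :
    F × F ⊕ F × F ≃ Link (triComplex φ) {(⟨i, QuotientGroup.mk g⟩ : Vertex φ)} 0 :=
  Equiv.ofBijective (fun m => ⟨{neighbour i g m}, neighbour_mem_link i g m⟩) <| by
    constructor
    · intro m m' h
      exact neighbour_injective hφ ht i g (Finset.singleton_injective (congrArg Subtype.val h))
    · rintro ⟨s, hs⟩
      obtain ⟨m, rfl⟩ := exists_eq_neighbour hs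
      exact ⟨m, rfl⟩

theorem edgeOf_mem_link (i : Fin 3) (g : bigGroup φ) (q : F × F × F) :
    edgeOf φ i (g * heis φ i q) ∈
      Link (triComplex φ) {(⟨i, QuotientGroup.mk g⟩ : Vertex φ)} 1 := by
  let _ : DecidableEq (Vertex φ) := fun a b => Classical.propDecidable (a = b)
  refine ⟨card_edgeOf _ _, ?_, ?_⟩
  · rw [Finset.disjoint_singleton_left]
    exact fun h => (mem_edgeOf.1 h).1 rfl
  · rw [vertex_union_edgeOf]
    exact triangleOf_mem_triComplex _

/-- The coordinates on the set of edges of the link of a vertex. -/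
noncomputable def linkEdgeEquiv (hφ : Irreducible φ) (ht : AdjoinRoot.root φ ≠ 0) (i : Fin 3)
    (g : bigGroup φ) :
    F × F × F ≃ Link (triComplex φ) {(⟨i, QuotientGroup.mk g⟩ : Vertex φ)} 1 :=
  Equiv.ofBijective (fun q => ⟨edgeOf φ i (g * heis φ i q), edgeOf_mem_link i g q⟩) <| by
    let _ : DecidableEq (Vertex φ) := fun a b => Classical.propDecidable (a = b)
    constructor
    · intro q q' h
      have h := congrArg Subtype.val h
      refine heis_injective hφ ht i (mul_left_cancel (a := g) (triangleOf_injective hφ ht ?_))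
      rw [← vertex_union_edgeOf, ← vertex_union_edgeOf]
      exact congrArg _ h
    · rintro ⟨s, hs1, hs2, hs3⟩
      obtain ⟨g', hg'⟩ := exists_eq_triangleOf hs3
        (by rw [Finset.card_union_of_disjoint hs2, hs1, Finset.card_singleton])
      have hv : (⟨i, QuotientGroup.mk g⟩ : Vertex φ) ∈ triangleOf φ g' := by
        rw [← hg']
        simp
      obtain ⟨q, rfl⟩ := exists_eq_mul_heis (mem_triangleOf.1 hv)
      refine ⟨q, Subtype.ext ?_⟩
      rw [← vertex_union_edgeOf] at hg'
      have h1 := (edgeOf_mem_link i g q).2.1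
      have h2 := congrArg (· \ {(⟨i, QuotientGroup.mk g⟩ : Vertex φ)}) hg'
      simp only [Finset.union_sdiff_cancel_left hs2, Finset.union_sdiff_cancel_left h1] at h2
      exact h2.symm

end LocalStructure

/-! ### Agreement testability -/

theorem unifProb_eq_of_equiv {A B : Type*} [Fintype A] (e : A ≃ B) (P : B → Prop)
    [DecidablePred fun a => P (e a)] :
    unifProb B P = ((Finset.univ.filter fun a => P (e a)).card : ℝ) / Fintype.card A := by
  rw [unifProb, ← Nat.card_congr e, Nat.card_eq_fintype_card (α := A),
    ← Nat.card_congr (e.subtypeEquiv (p := fun a => P (e a)) fun _ => Iff.rfl),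
    Nat.card_eq_fintype_card, Fintype.card_subtype]

open Classical in
/-- A collection of local views: a word on the triangles containing `uv`, for every vertex `u` of
the link of `v`. -/
abbrev LocalViews {V : Type*} (X : AbstractSimplicialComplex V) (v : V) (F : Type*) : Type _ :=
  (u : Link X {v} 0) → Star X ({v} ∪ u.1) 2 → F

section Testability

variable {p : ℕ} [Fact p.Prime] {φ : (ZMod p)[X]}

/-- Local views with few disagreements are mostly restrictions of a single word. -/
theorem exists_mem_vertexCode_of_disagreement (hφ : Irreducible φ) (ht : AdjoinRoot.root φ ≠ 0)
    (d : Fin 3 → ℕ) (i : Fin 3) (g : bigGroup φ) {A : ℕ}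
    (hA : 2 * (d (i + 1) + d (i - 1)) + 5 * A < p)
    (z : LocalViews (triComplex φ) ⟨i, QuotientGroup.mk g⟩ (ZMod p))
    (hz : ∀ u, z u ∈ edgeCode φ d _)
    (hdis : disagreement (triComplex φ) ⟨i, QuotientGroup.mk g⟩ z * (p : ℝ) ^ 3 <
      ((A : ℝ) + 1) ^ 3) :
    ∃ x ∈ vertexCode (triComplex φ) (edgeCode φ d) ⟨i, QuotientGroup.mk g⟩,
      distanceFrom (triComplex φ) ⟨i, QuotientGroup.mk g⟩ z x * p ≤ 2 * A := by
  classical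
  let _ : DecidableEq (Vertex φ) := fun a b => Classical.propDecidable (a = b)
  have hp : (0 : ℝ) < p := by exact_mod_cast (Fact.out : p.Prime).pos
  let v : Vertex φ := ⟨i, QuotientGroup.mk g⟩
  let U := linkVertexEquiv hφ ht i g
  have hUx (b c : ZMod p) : {v} ∪ (U (Sum.inl (b, c))).1 =
      edgeOf φ (i + 1) (g * heis φ i (0, b, c)) := vertex_union_neighbour_inl i g b c
  have hUy (a c : ZMod p) : {v} ∪ (U (Sum.inr (a, c))).1 =
      edgeOf φ (i - 1) (g * heis φ i (a, 0, c)) := vertex_union_neighbour_inr i g a c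
  have hmulx (a b c : ZMod p) : g * heis φ i (0, b, c) * hElt φ (i + 1) a =
      g * heis φ i (a, b, c) := by
    rw [mul_assoc, heis_mul_hElt_succ, zero_add]
  have hmuly (a y c : ZMod p) : g * heis φ i (a, 0, c) * hElt φ (i - 1) y =
      g * heis φ i (a, y, a * y + c) := by
    rw [mul_assoc, heis_mul_hElt_pred, zero_add, add_comm c]
  have hx (b c : ZMod p) : ∃ P : (ZMod p)[X], P.natDegree ≤ d (i + 1) ∧
      ∀ a t, t.1 = triangleOf φ (g * heis φ i (a, b, c)) → z (U (Sum.inl (b, c))) t = P.eval a := by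
    obtain ⟨P, hP, h⟩ := hz (U (Sum.inl (b, c))) (i + 1) _ (hUx b c)
    refine ⟨P, hP, fun a t ht => ?_⟩
    rw [← h a]
    exact congrArg _ (Subtype.ext (ht.trans (congrArg (triangleOf φ) (hmulx a b c)).symm))
  have hy (a c : ZMod p) : ∃ P : (ZMod p)[X], P.natDegree ≤ d (i - 1) ∧
      ∀ y t, t.1 = triangleOf φ (g * heis φ i (a, y, a * y + c)) →
        z (U (Sum.inr (a, c))) t = P.eval y := by
    obtain ⟨P, hP, h⟩ := hz (U (Sum.inr (a, c))) (i - 1) _ (hUy a c)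
    refine ⟨P, hP, fun y t ht => ?_⟩
    rw [← h y]
    exact congrArg _ (Subtype.ext (ht.trans (congrArg (triangleOf φ) (hmuly a y c)).symm))
  choose Z hZ hZz using hx
  choose W hW hWz using hy
  have hbad : (Finset.univ.filter fun q : ZMod p × ZMod p × ZMod p =>
      (Z q.2.1 q.2.2).eval q.1 ≠ (W q.1 (q.2.2 - q.1 * q.2.1)).eval q.2.1).card < (A + 1) ^ 3 := by
    rw [disagreement, unifProb_eq_of_equiv (linkEdgeEquiv hφ ht i g)] at hdis
    have hcard : (Fintype.card (ZMod p × ZMod p × ZMod p) : ℝ) = (p : ℝ) ^ 3 := by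
      simp only [Fintype.card_prod, ZMod.card]
      push_cast
      ring
    rw [hcard, div_mul_cancel₀ _ (by positivity)] at hdis
    refine lt_of_le_of_lt (Finset.card_le_card ?_) (by exact_mod_cast hdis)
    rintro ⟨a, b, c⟩ hq
    rw [Finset.mem_filter] at hq ⊢
    -- The x-line and the y-line through (a, b, c); the latter meets y = 0 at third coordinate c −
    -- ab.
    refine ⟨Finset.mem_univ _, U (Sum.inl (b, c)), U (Sum.inr (a, c - a * b)), ?_, ?_, ?_⟩
    · refine Finset.singleton_subset_iff.2 (mem_edgeOf.2 ⟨Fin.three_sub_one_ne i, ?_⟩)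
      rw [← hmulx]
      exact QuotientGroup.mk_mul_of_mem _
        (hElt_mem φ _ _ (Fin.three_add_one_ne_sub_one i).symm a)
    · refine Finset.singleton_subset_iff.2 (mem_edgeOf.2 ⟨Fin.three_add_one_ne i, ?_⟩)
      have h := hmuly a b (c - a * b)
      rw [add_sub_cancel] at h
      rw [← h]
      exact QuotientGroup.mk_mul_of_mem _ (hElt_mem φ _ _ (Fin.three_add_one_ne_sub_one i) b)
    · have h := vertex_union_edgeOf i g (a, b, c)
      have h' : a * b + (c - a * b) = c := add_sub_cancel _ _
      rw [hZz b c a _ h,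
        hWz a (c - a * b) b _
          (h.trans (congrArg (fun r => triangleOf φ (g * heis φ i (a, b, r))) h'.symm))]
      exact hq.2
  obtain ⟨f, hf, hfZ, hfW⟩ := exists_mem_skewCode_of_agreement hA Z W hZ hW hbad
  let e := starEquiv hφ ht i g
  refine ⟨f ∘ e.symm, ?_, ?_⟩
  · rw [mem_vertexCode_iff hφ ht]
    convert hf using 1
    ext q
    simp [e]
  · rw [distanceFrom, unifProb_eq_of_equiv U]
    have hcard : (Fintype.card (ZMod p × ZMod p ⊕ ZMod p × ZMod p) : ℝ) = 2 * (p : ℝ) ^ 2 := by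
      simp only [Fintype.card_sum, Fintype.card_prod, ZMod.card]
      push_cast
      ring
    have hval (q : ZMod p × ZMod p × ZMod p) {t : Finset (Vertex φ)} (ht')
        (h : t = triangleOf φ (g * heis φ i q)) : (f ∘ e.symm) ⟨t, ht'⟩ = f q :=
      congrArg f (e.symm_apply_eq.2 (Subtype.ext h))
    -- At most 2Ap bad lines in each direction, among 2p^2 link vertices in total, is a fraction of
    -- at most 2A/p.
    rw [hcard, div_mul_eq_mul_div, div_le_iff₀ (by positivity)]
    have hrhs : 2 * A * (2 * (p : ℝ) ^ 2) = ((p * (2 * A) + p * (2 * A) : ℕ) : ℝ) * p := by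
      push_cast
      ring
    rw [hrhs]
    refine mul_le_mul_of_nonneg_right (Nat.cast_le.2 ?_) hp.le
    refine (Finset.card_le_card ?_).trans
      ((Finset.card_disjSum _ _).trans_le (add_le_add hfZ hfW))
    rintro (⟨b, c⟩ | ⟨a, c⟩) hm
    · rw [Finset.inl_mem_disjSum, Finset.mem_filter]
      refine ⟨Finset.mem_univ _, ?_⟩
      by_contra! hcon
      refine (Finset.mem_filter.1 hm).2 (funext fun t => ?_)
      obtain ⟨a, ha⟩ := exists_eq_triangleOf_mul_hElt hφ ht (by rw [← hUx b c]; exact t.2)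
      rw [hmulx] at ha
      rw [hZz b c a t ha, hval _ _ ha, hcon]
    · rw [Finset.inr_mem_disjSum, Finset.mem_filter]
      refine ⟨Finset.mem_univ _, ?_⟩
      by_contra! hcon
      refine (Finset.mem_filter.1 hm).2 (funext fun t => ?_)
      obtain ⟨y, hy⟩ := exists_eq_triangleOf_mul_hElt hφ ht (by rw [← hUy a c]; exact t.2)
      rw [hmuly] at hy
      rw [hWz a c y t hy, hval _ _ hy, hcon]

theorem agreementTestable_vertexCode (hφ : Irreducible φ) (ht : AdjoinRoot.root φ ≠ 0)
    (d : Fin 3 → ℕ) (i : Fin 3) (g : bigGroup φ)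
    (hd : (d (i + 1) : ℝ) + d (i - 1) < p / 2) :
    AgreementTestable (triComplex φ) (edgeCode φ d) ⟨i, QuotientGroup.mk g⟩
      (((p - 2 * ((d (i + 1) : ℝ) + d (i - 1))) / (5 * p)) ^ 3)
      (fun α => 4 * α ^ (1 / 3 : ℝ)) := by
  have hp : (0 : ℝ) < p := by exact_mod_cast (Fact.out : p.Prime).pos
  have hr : 0 < (p - 2 * ((d (i + 1) : ℝ) + d (i - 1))) / (5 * p) :=
    div_pos (by linarith) (by positivity)
  refine ⟨pow_pos hr 3, fun α hα => ?_, fun α hα β _ h => ?_, fun z hz hlt => ?_⟩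
  · have : 0 ≤ α ^ (1 / 3 : ℝ) := Real.rpow_nonneg hα _
    simpa using this
  · have := Real.rpow_lt_rpow hα h (by norm_num : (0 : ℝ) < 1 / 3)
    simpa using this
  · have h0 : 0 ≤ disagreement (triComplex φ) ⟨i, QuotientGroup.mk g⟩ z :=
      div_nonneg (Nat.cast_nonneg _) (Nat.cast_nonneg _)
    set δ := disagreement (triComplex φ) ⟨i, QuotientGroup.mk g⟩ z with hδ
    set s := δ ^ (1 / 3 : ℝ) with hs
    have hs0 : 0 ≤ s := Real.rpow_nonneg h0 _
    have hs3 : s ^ 3 = δ := by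
      rw [hs, ← Real.rpow_natCast, ← Real.rpow_mul h0]
      norm_num
    have hsr : s < (p - 2 * ((d (i + 1) : ℝ) + d (i - 1))) / (5 * p) :=
      lt_of_pow_lt_pow_left₀ 3 hr.le (by rwa [hs3])
    have hsp : 0 ≤ s * p := by positivity
    have hfl : (⌊s * p⌋₊ : ℝ) ≤ s * p := Nat.floor_le hsp
    -- The floor is the least A with (sp)^3 < (A + 1)^3, and 5sp < p − 2(d_x + d_y) is the
    -- hypothesis on the disagreement. The resulting distance is at most 2s, within the required 4s.
    obtain ⟨x, hx, hdist⟩ := exists_mem_vertexCode_of_disagreement hφ ht d i g (A := ⌊s * p⌋₊)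
      (by
        rw [lt_div_iff₀ (by positivity)] at hsr
        have : 2 * ((d (i + 1) : ℝ) + d (i - 1)) + 5 * ⌊s * p⌋₊ < p := by linarith
        exact_mod_cast this) z hz
      (by
        rw [← hδ, ← hs3, ← mul_pow]
        exact pow_lt_pow_left₀ (Nat.lt_floor_add_one _) hsp (by norm_num))
    refine ⟨x, hx, ?_⟩
    change _ ≤ 4 * s
    have : distanceFrom (triComplex φ) ⟨i, QuotientGroup.mk g⟩ z x * p ≤ (4 * s) * p := by
      linarith
    exact le_of_mul_le_mul_right this hp

end Testability

end HDXCode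

theorem mainTheorem5 (p : ℕ) [Fact p.Prime] (φ : Polynomial (ZMod p))
    (hφ : HDXCode.IsPrimitivePoly φ) (d : Fin 3 → ℕ) (v : HDXCode.Vertex φ) (dx dy : ℕ)
    (hdx : dx = d (v.1 + 1)) (hdy : dy = d (v.1 - 1)) (hd : (dx : ℝ) + dy < p / 2) :
    (∃ e : (ZMod p × ZMod p × ZMod p) ≃ HDXCode.Star (HDXCode.triComplex φ) {v} 2,
      ∀ f : HDXCode.Star (HDXCode.triComplex φ) {v} 2 → ZMod p,
        f ∈ HDXCode.vertexCode (HDXCode.triComplex φ) (HDXCode.edgeCode φ d) v ↔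
          f ∘ e ∈ HDXCode.skewCode (ZMod p) dx dy) ∧
    HDXCode.AgreementTestable (HDXCode.triComplex φ) (HDXCode.edgeCode φ d) v
      (((p - 2 * ((dx : ℝ) + dy)) / (5 * p)) ^ 3) (fun α => 4 * α ^ (1 / 3 : ℝ)) := by
  have ht := hφ.root_ne_zero
  obtain ⟨i, w⟩ := v
  obtain ⟨g, rfl⟩ := QuotientGroup.mk_surjective w
  subst hdx hdy
  exact ⟨⟨HDXCode.starEquiv hφ.1 ht i g, HDXCode.mem_vertexCode_iff hφ.1 ht d i g⟩,
    HDXCode.agreementTestable_vertexCode hφ.1 ht d i g hd⟩
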